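/- Let $\gamma>0$ and $p>0$ be fixed. Let $X_1,X_2,\dots$ be iid real random variables with distribution function $F$ and quantile function $Q(s)=\inf\{x: F(x)\ge s\}$, $s\in(0,1)$, and write $X_{1,n}\le\dots\le X_{n,n}$ for the order statistics of $X_1,\dots,X_n$. Let $U_1,U_2,\dots$ be iid uniform$(0,1)$ random variables with order statistics $U_{1,n}\le\dots\le U_{n,n}$. Assume that $$Q(1-s)=s^{-\gamma}\ell(s),\qquad s\in(0,1),$$ where $\ell$ is slowly varying at $0$. Assume that there are a function $a$, regularly varying at $0$, and a Borel set $B\subset[0,1]$ of positive Lebesgue measure such that $$\lim_{v\downarrow0}\frac{a(v)}{\ell(v)}=0\qquad\text{and}\qquad \limsup_{v\downarrow 0}\frac{|\ell(uv)-\ell(v)|}{a(v)}<\infty\quad\text{for every }u\in B.$$ (Regularly varying functions are, near $0$, positive and measurable.) Let $1\le k_n\le n$ be integers with $k_n\to\infty$, $k_n/n\to0$ and $$\sqrt{k_n}\,\frac{a(k_n/n)}{\ell(k_n/n)}\to0 .$$ Put $\sigma_p^2=\gamma^{2p}\bigl(\Gamma(2p+1)-\Gamma(p+1)^2\bigr)$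 and $$S_n(p)=\frac1{k_n}\sum_{i=1}^{k_n}\Bigl(\log\frac{X_{n+1-i,n}}{X_{n-k_n,n}}\Bigr)^p,\qquad \widehat\gamma(n)=\Bigl(\frac{S_n(p)}{\Gamma(p+1)}\Bigr)^{1/p}.$$ Then, as $n\to\infty$, $$\frac1{\sqrt{k_n}}\sum_{i=1}^{k_n}\Bigl[\Bigl(\log\frac{Q(1-U_{i,n})}{Q(1-U_{k_n+1,n})}\Bigr)^p-\gamma^p\,\Gamma(p+1)\Bigr]\ \xrightarrow{\ \mathcal D\ }\ N(0,\sigma_p^2)$$ and $$p\sqrt{k_n}\,\bigl(\widehat\gamma(n)-\gamma\bigr)\ \xrightarrow{\ \mathcal D\ }\ N(0,\widetilde\sigma_p^2),\qquad \widetilde\sigma_p^2=\frac{\gamma^{2(1-p)}\,\sigma_p^2}{\Gamma(p+1)^2}.$$ -/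

import Mathlib

open MeasureTheory ProbabilityTheory Filter Topology

namespace TailIndex

/-- `f` is regularly varying at `0` (from the right) with index `ρ`: near `0` it is positive and
Lebesgue measurable, and `f (u v) / f v → u ^ ρ` as `v ↓ 0`, for every `u > 0`. -/
def RegularlyVaryingAtZeroWith (ρ : ℝ) (f : ℝ → ℝ) : Prop :=
  (∃ δ : ℝ, 0 < δ ∧ (∀ v ∈ Set.Ioo (0 : ℝ) δ, 0 < f v) ∧
    AEMeasurable f (volume.restrict (Set.Ioo (0 : ℝ) δ))) ∧
  ∀ u : ℝ, 0 < u → Tendsto (fun v => f (u * v) / f v) (𝓝[>] 0) (𝓝 (u ^ ρ))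

/-- `f` is regularly varying at `0`, with some real index. -/
def RegularlyVaryingAtZero (f : ℝ → ℝ) : Prop :=
  ∃ ρ : ℝ, RegularlyVaryingAtZeroWith ρ f

/-- `f` is slowly varying at `0`: regularly varying with index `0`. -/
def SlowlyVaryingAtZero (f : ℝ → ℝ) : Prop :=
  RegularlyVaryingAtZeroWith 0 f

/-- The quantile function `Q(s) = inf {x : F(x) ≥ s}`, `s ∈ (0,1)`, of the distribution `μ`,
where `F` is its distribution function. -/
noncomputable def quantile (μ : Measure ℝ) (s : ℝ) : ℝ :=
  sInf {x : ℝ | s ≤ cdf μ x}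

/-- The `i`-th smallest element (`1 ≤ i ≤ n`, ties listed repeatedly) of the first `n` terms
`x 0, …, x (n - 1)` of the sequence `x`; it is set to `0` when `i` is out of range. -/
noncomputable def orderStat (x : ℕ → ℝ) (n i : ℕ) : ℝ :=
  if h : 1 ≤ i ∧ i ≤ n then
    x (Tuple.sort (fun j : Fin n => x j) ⟨i - 1, by omega⟩)
  else 0

/-- `S_n(p) = k⁻¹ ∑_{i=1}^{k} (log (x_{n+1-i,n} / x_{n-k,n}))^p` for the sample
`x 0, …, x (n - 1)`. -/
noncomputable def powerSum (p : ℝ) (k n : ℕ) (x : ℕ → ℝ) : ℝ :=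
  (k : ℝ)⁻¹ * ∑ i ∈ Finset.Icc 1 k,
    (Real.log (orderStat x n (n + 1 - i) / orderStat x n (n - k))) ^ p

/-- The estimator `(S_n(p) / Γ(p+1))^{1/p}` of the tail index. -/
noncomputable def tailEstimator (p : ℝ) (k n : ℕ) (x : ℕ → ℝ) : ℝ :=
  (powerSum p k n x / Real.Gamma (p + 1)) ^ (1 / p)

/-- `σ_p² = γ^{2p} (Γ(2p+1) - Γ(p+1)²)`. -/
noncomputable def sigmaSq (γ p : ℝ) : ℝ :=
  γ ^ (2 * p) * (Real.Gamma (2 * p + 1) - Real.Gamma (p + 1) ^ 2)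

end TailIndex

/-!
Asymptotic normality of power sums of log-spacings of upper order statistics, and of the tail index
estimator built from them.

Write `q s = Q (1 - s)`, `W = U_{k+1,n}` and `g = a / ℓ`. Given `W = w`, the `k` smallest uniform
order statistics are those of a sample from the uniform law on `(0, w)`. Since the sum is symmetric
in them, its characteristic function is the mean over `W` of the `k`-th power of
`∫ exp (i t ξ (w v, w)) dv`, where `ξ (u, w)` is the summand with `U_{i,n} = u` and `W = w`
(`integral_prod_sortedTuple`). This identity comes from summing over the
index of the observation of rank `k + 1` and over the set of the observations below it; no
representation by exponential spacings is needed. Specialized to the constant `1`, it also gives the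
moments of `W`, so that `W` concentrates around `k / n` (`norm_integral_prod_sortedTuple_sub_le`,
`tendsto_relative_variance`).

For `v` uniform, `log (q (w v) / q w) = -γ log v + log (ℓ (w v) / ℓ w)`, where `-γ log v` is
exponential with mean `γ`. The pointwise condition on a set `B` of positive measure is first made
locally uniform, by the measure-theoretic argument behind the uniform convergence theorem
(`exists_uniform_comparableAt`), then iterated to
`|log ℓ (w v) - log ℓ w| ≤ C g(w) v ^ (-ε)` (`exists_potter_bound`). As `√k g (k / n) → 0`,
replacing the log-ratio by `-γ log v` changes the `k`-th power above by `o(1)`, uniformly for `w`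
comparable to `k / n` (`exists_approx_log_ratio`). What remains is the central limit theorem for
the variables `(-γ log v) ^ p`, with mean `γ ^ p Γ(p + 1)` and variance `σ_p²`
(`tendsto_integral_cexp_pow`), and Lévy's continuity theorem.

For the estimator, the sample `X` has the law of the sequence `q (U_j)`, and `q` is antitone, so
`S_n(p)` has the law of `γ ^ p Γ(p + 1) + T_n / √k`, with `T_n` the normalized sum of the first
part. The delta method for `z ↦ z ^ (1 / p)` concludes (`tendstoInDistribution_rpow_delta`).
-/

/-! ### Regular variation: uniform bounds from pointwise bounds -/

/-- Passing from `y` to `s * y` changes `φ` by at most `C * g y`, and `g` by a factor at most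
`C` up or down. -/
def ComparableAt (φ g : ℝ → ℝ) (C y s : ℝ) : Prop :=
  |φ (s * y) - φ y| ≤ C * g y ∧ g (s * y) ≤ C * g y ∧ g y ≤ C * g (s * y)

lemma ComparableAt.mono {φ g : ℝ → ℝ} {C C' y s : ℝ} (h : ComparableAt φ g C y s) (hC : C ≤ C')
    (hy : 0 ≤ g y) (hsy : 0 ≤ g (s * y)) : ComparableAt φ g C' y s :=
  ⟨h.1.trans (by gcongr), h.2.1.trans (by gcongr), h.2.2.trans (by gcongr)⟩

/-- If every point of `K` admits a comparison constant along `y → 0`, then for large `N` the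
constant `N` works at `y N` on all of `K` but a part of small measure. -/
lemma exists_subset_comparableAt {φ g : ℝ → ℝ} {δ : ℝ}
    (hφ : AEMeasurable φ (volume.restrict (Set.Ioo 0 δ)))
    (hg : AEMeasurable g (volume.restrict (Set.Ioo 0 δ)))
    (hpos : ∀ v ∈ Set.Ioo 0 δ, 0 < g v) {K : Set ℝ} (hK : MeasurableSet K)
    (hK1 : K ⊆ Set.Ioo 0 1)
    (hb : ∀ s ∈ K, ∃ C : ℝ, ∀ᶠ v in 𝓝[>] 0, ComparableAt φ g C v s)
    {y : ℕ → ℝ} (hy : ∀ n, y n ∈ Set.Ioo 0 δ) (hy0 : Tendsto y atTop (𝓝 0))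
    {b : ENNReal} (hbK : b < volume K) :
    ∀ᶠ N : ℕ in atTop, ∃ V ⊆ K, MeasurableSet V ∧ b < volume V ∧
      ∀ s ∈ V, ComparableAt φ g N (y N) s := by
  have hsy : ∀ s ∈ K, ∀ n, s * y n ∈ Set.Ioo 0 δ := fun s hs n =>
    ⟨mul_pos (hK1 hs).1 (hy n).1,
      (mul_le_of_le_one_left (hy n).1.le (hK1 hs).2.le).trans_lt (hy n).2⟩
  set V : ℕ → Set ℝ := fun N => {s ∈ K | ∀ m, N ≤ m → ComparableAt φ g N (y m) s} with hV
  have hmono : Monotone V := by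
    intro N M hNM s hs
    exact ⟨hs.1, fun m hm => (hs.2 m (hNM.trans hm)).mono (by exact_mod_cast hNM)
      (hpos _ (hy m)).le (hpos _ (hsy s hs.1 m)).le⟩
  have hU : ⋃ N, V N = K := by
    refine Set.Subset.antisymm (Set.iUnion_subset fun N => Set.sep_subset _ _) fun s hs => ?_
    obtain ⟨C, hC⟩ := hb s hs
    have hy' : Tendsto y atTop (𝓝[>] 0) :=
      tendsto_nhdsWithin_iff.2 ⟨hy0, Eventually.of_forall fun n => (hy n).1⟩
    obtain ⟨M, hM⟩ := eventually_atTop.1 (hy'.eventually hC)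
    obtain ⟨N', hN'⟩ := exists_nat_ge C
    refine Set.mem_iUnion.2 ⟨max M N', hs, fun m hm => (hM m ((le_max_left _ _).trans hm)).mono
      (hN'.trans (by exact_mod_cast le_max_right _ _)) (hpos _ (hy m)).le
      (hpos _ (hsy s hs m)).le⟩
  have hlim := tendsto_measure_iUnion_atTop (μ := volume) hmono
  rw [hU] at hlim
  have hqmp : ∀ n, Measure.QuasiMeasurePreserving (fun s : ℝ => s * y n)
      (volume.restrict K) (volume.restrict (Set.Ioo 0 δ)) := fun n => by
    have := Measure.quasiMeasurePreserving_smul (volume : Measure ℝ) (hy n).1.ne'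
    simp only [smul_eq_mul, mul_comm (y n)] at this
    exact this.restrict fun s hs => hsy s hs n
  filter_upwards [hlim.eventually (lt_mem_nhds hbK)] with N hN
  have hnull : NullMeasurableSet {s | ∀ m, N ≤ m → ComparableAt φ g N (y m) s}
      (volume.restrict K) := by
    have : {s | ∀ m, N ≤ m → ComparableAt φ g N (y m) s}
        = ⋂ m, ⋂ (_ : N ≤ m), {s | ComparableAt φ g N (y m) s} := by ext; simp
    rw [this]
    refine NullMeasurableSet.iInter fun m => NullMeasurableSet.iInter fun _ => ?_
    have h1 : AEMeasurable (fun s => φ (s * y m)) (volume.restrict K) :=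
      hφ.comp_quasiMeasurePreserving (hqmp m)
    have h2 : AEMeasurable (fun s => g (s * y m)) (volume.restrict K) :=
      hg.comp_quasiMeasurePreserving (hqmp m)
    refine (nullMeasurableSet_le (f := fun s => |φ (s * y m) - φ (y m)|)
      (g := fun _ => (N : ℝ) * g (y m)) ?_ aemeasurable_const).inter
      ((nullMeasurableSet_le (f := fun s => g (s * y m)) (g := fun _ => (N : ℝ) * g (y m)) h2
        aemeasurable_const).inter (nullMeasurableSet_le (f := fun _ => g (y m))
        (g := fun s => (N : ℝ) * g (s * y m)) aemeasurable_const (h2.const_mul _)))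
    exact (continuous_abs.measurable.comp_aemeasurable (h1.sub_const _))
  obtain ⟨V', hV'1, hV'2, hV'3⟩ := hnull.exists_measurable_subset_ae_eq
  refine ⟨V' ∩ K, Set.inter_subset_right, hV'2.inter hK, ?_, fun s hs => hV'1 hs.1 N le_rfl⟩
  have h3 := measure_congr hV'3
  rw [Measure.restrict_apply hV'2, Measure.restrict_apply' hK] at h3
  rw [h3]
  have h4 : {s | ∀ m, N ≤ m → ComparableAt φ g N (y m) s} ∩ K = V N := by
    ext s; simp [hV, and_comm]
  rwa [h4]

open scoped Pointwise in
/-- A pointwise bound on a set of positive measure is locally uniform. The argument is the one for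
the uniform convergence theorem of regular variation: if uniformity fails along `v n → 0` and
`t n`, the sets of good `s` at `v n`, and of good `w` at `t n * v n`, fill most of `K`, so some
good `s` equals `t n * w`, and the two comparisons combine. -/
lemma exists_uniform_comparableAt {φ g : ℝ → ℝ} {δ : ℝ} (hδ : 0 < δ)
    (hφ : AEMeasurable φ (volume.restrict (Set.Ioo 0 δ)))
    (hg : AEMeasurable g (volume.restrict (Set.Ioo 0 δ)))
    (hpos : ∀ v ∈ Set.Ioo 0 δ, 0 < g v) {B : Set ℝ} (hB : MeasurableSet B)
    (hB1 : B ⊆ Set.Ioo 0 1) (hB0 : 0 < volume B)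
    (hb : ∀ s ∈ B, ∃ C : ℝ, ∀ᶠ v in 𝓝[>] 0, ComparableAt φ g C v s) :
    ∃ r ∈ Set.Ioo (0 : ℝ) 1, ∃ C : ℝ, 0 < C ∧
      ∀ᶠ v in 𝓝[>] 0, ∀ t ∈ Set.Icc r 1, ComparableAt φ g C v t := by
  obtain ⟨K, hKB, hKc, hK0⟩ := hB.exists_lt_isCompact hB0
  have hK1 := hKB.trans hB1
  have hKtop : volume K ≠ ⊤ := hKc.measure_lt_top.ne
  set κ : ℝ := volume.real K with hκ
  have hκ0 : 0 < κ := ENNReal.toReal_pos hK0.ne' hKtop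
  have hκK : volume K = ENNReal.ofReal κ := (ENNReal.ofReal_toReal hKtop).symm
  obtain ⟨O, hKO, hO, hOlt⟩ := hKc.exists_isOpen_lt_add (μ := volume)
    (ε := ENNReal.ofReal (κ / 4)) (by simpa using by positivity)
  obtain ⟨η, hη, hηO⟩ := hKc.exists_thickening_subset_open hO hKO
  -- `t • K ⊆ O` for `t ∈ [r, 1]`, and `9 / 10 * (3 / 4) + 3 / 4 > 5 / 4` forces the two sets of
  -- good points, both contained in `O`, to meet
  set r : ℝ := max (9 / 10) (1 - η / 2) with hr
  have hr0 : 0 < r := lt_of_lt_of_le (by norm_num) (le_max_left _ _)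
  have hr1 : r < 1 := max_lt (by norm_num) (by linarith)
  refine ⟨r, ⟨hr0, hr1⟩, ?_⟩
  by_contra! hcon
  -- the constant is the one obtained below by composing two comparisons with constant `n`
  have hex : ∀ n : ℕ, ∃ v ∈ Set.Ioo 0 (min δ (1 / ((n : ℝ) + 1))), ∃ t ∈ Set.Icc r 1,
      ¬ ComparableAt φ g ((n : ℝ) ^ 3 + n ^ 2 + n + 1) v t := by
    intro n
    have h1 := hcon ((n : ℝ) ^ 3 + n ^ 2 + n + 1) (by positivity)
    have h2 : ∀ᶠ v in 𝓝[>] (0 : ℝ), v ∈ Set.Ioo 0 (min δ (1 / ((n : ℝ) + 1))) :=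
      Ioo_mem_nhdsGT (lt_min hδ (by positivity))
    obtain ⟨v, hv1, hv2⟩ := (h1.and_eventually h2).exists
    exact ⟨v, hv2, hv1⟩
  choose v hv t ht hvt using hex
  have hvδ : ∀ n, v n ∈ Set.Ioo 0 δ := fun n => ⟨(hv n).1, (hv n).2.trans_le (min_le_left _ _)⟩
  have htv : ∀ n, t n * v n ∈ Set.Ioo 0 δ := fun n =>
    ⟨mul_pos (hr0.trans_le (ht n).1) (hvδ n).1,
      (mul_le_of_le_one_left (hvδ n).1.le (ht n).2).trans_lt (hvδ n).2⟩
  have hv0 : Tendsto v atTop (𝓝 0) :=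
    squeeze_zero (fun n => (hv n).1.le) (fun n => ((hv n).2.trans_le (min_le_right _ _)).le)
      tendsto_one_div_add_atTop_nhds_zero_nat
  have htv0 : Tendsto (fun n => t n * v n) atTop (𝓝 0) :=
    squeeze_zero (fun n => (htv n).1.le)
      (fun n => mul_le_of_le_one_left (hvδ n).1.le (ht n).2) hv0
  have hlt : ENNReal.ofReal (3 / 4 * κ) < volume K := by
    rw [hκK]; exact (ENNReal.ofReal_lt_ofReal_iff hκ0).2 (by linarith)
  have hKm := hKc.measurableSet
  have hbK : ∀ s ∈ K, ∃ C : ℝ, ∀ᶠ v in 𝓝[>] 0, ComparableAt φ g C v s := fun s hs => hb s (hKB hs)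
  obtain ⟨N, ⟨V, hVK, hVm, hVμ, hV⟩, ⟨W, hWK, hWm, hWμ, hW⟩⟩ :=
    ((exists_subset_comparableAt hφ hg hpos hKm hK1 hbK hvδ hv0 hlt).and
      (exists_subset_comparableAt hφ hg hpos hKm hK1 hbK htv htv0 hlt)).exists
  have htN := ht N
  have htN0 : 0 < t N := hr0.trans_le htN.1
  have hWO : t N • W ⊆ O := by
    rintro _ ⟨w, hw, rfl⟩
    refine hηO (Metric.mem_thickening_iff.2 ⟨w, hWK hw, ?_⟩)
    have hw1 := hK1 (hWK hw)
    have : 1 - η / 2 ≤ t N := (le_max_right _ _).trans htN.1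
    simp only [smul_eq_mul, Real.dist_eq]
    rw [abs_lt]
    constructor <;> nlinarith [hw1.1, hw1.2, htN.2]
  have hne : (t N • W ∩ V).Nonempty := by
    refine nonempty_inter_of_measure_lt_add volume hVm hWO (hVK.trans hKO) ?_
    rw [Measure.addHaar_smul]
    calc volume O < volume K + ENNReal.ofReal (κ / 4) := hOlt
      _ = ENNReal.ofReal (5 / 4 * κ) := by
        rw [hκK, ← ENNReal.ofReal_add hκ0.le (by positivity)]; ring_nf
      _ ≤ ENNReal.ofReal (9 / 10 * (3 / 4 * κ) + 3 / 4 * κ) :=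
        ENNReal.ofReal_le_ofReal (by nlinarith)
      _ = ENNReal.ofReal (9 / 10) * ENNReal.ofReal (3 / 4 * κ) + ENNReal.ofReal (3 / 4 * κ) := by
        rw [ENNReal.ofReal_add (by positivity) (by positivity),
          ENNReal.ofReal_mul (by norm_num : (0 : ℝ) ≤ 9 / 10)]
      _ ≤ _ := by
        gcongr
        rw [Module.finrank_self, pow_one, abs_of_pos htN0]
        exact (le_max_left _ _).trans htN.1
  obtain ⟨_, ⟨w, hw, rfl⟩, hs⟩ := hne
  obtain ⟨a1, a2, a3⟩ := hV _ hs
  obtain ⟨b1, b2, b3⟩ := hW w hw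
  simp only [smul_eq_mul] at a1 a2 a3
  have hcomm : w * (t N * v N) = t N * w * v N := by ring
  rw [hcomm] at b1 b2 b3
  apply hvt N
  have gv := hpos _ (hvδ N)
  have gtv := hpos _ (htv N)
  have hN0 : (0 : ℝ) ≤ N := Nat.cast_nonneg N
  have c1 : g (t N * v N) ≤ N ^ 2 * g (v N) := b3.trans (by nlinarith)
  have c2 : g (v N) ≤ N ^ 2 * g (t N * v N) := a3.trans (by nlinarith)
  have hN2 : (N : ℝ) ^ 2 ≤ N ^ 3 + N ^ 2 + N + 1 := by nlinarith [pow_nonneg hN0 3]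
  refine ⟨?_, c1.trans (by gcongr), c2.trans (by gcongr)⟩
  have e1 : |φ (t N * v N) - φ (v N)| ≤ N * g (t N * v N) + N * g (v N) := by
    rw [abs_le] at a1 b1 ⊢
    constructor <;> linarith [a1.1, a1.2, b1.1, b1.2]
  have e2 : N * g (t N * v N) ≤ N ^ 3 * g (v N) := by nlinarith
  nlinarith [pow_nonneg hN0 2]

/-- Iteration of the local bound: a Potter-type bound on all of `(0, 1]`. Since `g → 0`, its
index is nonnegative, so that `g (r ^ j * v)` grows slower than any negative power of `r ^ j`. -/
lemma exists_potter_bound {φ g : ℝ → ℝ} {ρ r C ε : ℝ} (hr : r ∈ Set.Ioo (0 : ℝ) 1) (hC : 0 < C)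
    (hε : 0 < ε) (hpos : ∀ᶠ v in 𝓝[>] 0, 0 < g v) (hg0 : Tendsto g (𝓝[>] 0) (𝓝 0))
    (hreg : Tendsto (fun v => g (r * v) / g v) (𝓝[>] 0) (𝓝 (r ^ ρ)))
    (hloc : ∀ᶠ v in 𝓝[>] 0, ∀ t ∈ Set.Icc r 1, ComparableAt φ g C v t) :
    ∃ C' : ℝ, 0 < C' ∧ ∀ᶠ v in 𝓝[>] 0, ∀ t ∈ Set.Ioc (0 : ℝ) 1,
      |φ (t * v) - φ v| ≤ C' * g v * t ^ (-ε) := by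
  obtain ⟨hr0, hr1⟩ := hr
  have hev : ∀ {p : ℝ → Prop}, (∀ᶠ v in 𝓝[>] 0, p v) → ∃ s > 0, ∀ v ∈ Set.Ioo (0 : ℝ) s, p v := by
    intro p hp
    obtain ⟨s, hs, hs'⟩ := mem_nhdsGT_iff_exists_Ioo_subset.1 hp
    exact ⟨s, hs, fun v hv => hs' hv⟩
  have hiter : ∀ {s v : ℝ}, v ∈ Set.Ioo 0 s → ∀ j : ℕ, r ^ j * v ∈ Set.Ioo 0 s := fun {s v} hv j =>
    ⟨mul_pos (pow_pos hr0 j) hv.1,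
      (mul_le_of_le_one_left hv.1.le (pow_le_one₀ hr0.le hr1.le)).trans_lt hv.2⟩
  -- a negative index would make `g` bounded below along the sequence `r ^ j * (s / 2)`
  have hρ : r ^ ρ ≤ 1 := by
    by_contra! hlt
    obtain ⟨s, hs, hs'⟩ := hev (hpos.and (hreg.eventually (lt_mem_nhds hlt)))
    have hv : s / 2 ∈ Set.Ioo 0 s := ⟨by positivity, by linarith⟩
    have hj : ∀ j : ℕ, g (s / 2) ≤ g (r ^ j * (s / 2)) := by
      intro j
      induction j with
      | zero => simp
      | succ j ih =>
        have h1 := hs' _ (hiter hv j)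
        have h2 := (one_lt_div h1.1).1 h1.2
        rw [pow_succ', mul_assoc]
        linarith
    have hlim : Tendsto (fun j : ℕ => r ^ j * (s / 2)) atTop (𝓝[>] 0) := by
      refine tendsto_nhdsWithin_iff.2 ⟨?_, Eventually.of_forall fun j => (hiter hv j).1⟩
      simpa using (tendsto_pow_atTop_nhds_zero_of_lt_one hr0.le hr1).mul_const (s / 2)
    have := ge_of_tendsto' (hg0.comp hlim) hj
    linarith [(hs' _ hv).1]
  set θ : ℝ := r ^ (-ε) with hθ
  have hθ1 : 1 < θ := Real.one_lt_rpow_of_pos_of_lt_one_of_neg hr0 hr1 (by linarith)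
  obtain ⟨s, hs, hs'⟩ := hev ((hpos.and (hreg.eventually
    (gt_mem_nhds (hρ.trans_lt hθ1)))).and hloc)
  refine ⟨C * (1 + 1 / (θ - 1)), by have : 0 < θ - 1 := by linarith
                                    positivity, ?_⟩
  filter_upwards [Ioo_mem_nhdsGT hs] with v hv t ht
  have hgv := (hs' v hv).1.1
  have hgj : ∀ j : ℕ, g (r ^ j * v) ≤ θ ^ j * g v := by
    intro j
    induction j with
    | zero => simp
    | succ j ih =>
      have h1 := (hs' _ (hiter hv j)).1
      have h2 := (div_le_iff₀ h1.1).1 h1.2.le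
      rw [pow_succ', mul_assoc, pow_succ', mul_assoc]
      exact h2.trans (by gcongr)
  have hφj : ∀ j : ℕ, |φ (r ^ j * v) - φ v| ≤ C * g v * ((θ ^ j - 1) / (θ - 1)) := by
    intro j
    induction j with
    | zero => simp
    | succ j ih =>
      have h1 := ((hs' _ (hiter hv j)).2 r ⟨le_rfl, hr1.le⟩).1
      have h3 : C * g (r ^ j * v) ≤ C * (θ ^ j * g v) := by gcongr; exact hgj j
      have h4 : C * g v * ((θ ^ (j + 1) - 1) / (θ - 1))
          = C * g v * ((θ ^ j - 1) / (θ - 1)) + C * (θ ^ j * g v) := by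
        have : θ - 1 ≠ 0 := by linarith
        field_simp
        ring
      rw [h4, pow_succ', mul_assoc]
      have := abs_sub_le (φ (r * (r ^ j * v))) (φ (r ^ j * v)) (φ v)
      linarith
  obtain ⟨j, hj1, hj2⟩ := exists_nat_pow_near_of_lt_one ht.1 ht.2 hr0 hr1
  have hrj : 0 < r ^ j := pow_pos hr0 j
  have h1 := ((hs' _ (hiter hv j)).2 (t / r ^ j) ⟨by
    rw [le_div_iff₀ hrj, ← pow_succ']; exact hj1.le, by rwa [div_le_one hrj]⟩).1
  have h2 : t / r ^ j * (r ^ j * v) = t * v := by field_simp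
  rw [h2] at h1
  have h3 : C * g (r ^ j * v) ≤ C * (θ ^ j * g v) := by gcongr; exact hgj j
  have h4 : θ ^ j ≤ t ^ (-ε) := by
    have : θ ^ j = (r ^ j) ^ (-ε) := by
      rw [hθ, ← Real.rpow_natCast, ← Real.rpow_natCast, ← Real.rpow_mul hr0.le,
        ← Real.rpow_mul hr0.le, mul_comm]
    rw [this]
    exact Real.rpow_le_rpow_of_nonpos ht.1 hj2 (by linarith)
  have h5 : (θ ^ j - 1) / (θ - 1) ≤ θ ^ j * (1 / (θ - 1)) := by
    rw [mul_one_div]; gcongr; linarith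
  calc |φ (t * v) - φ v| ≤ C * g (r ^ j * v) + C * g v * ((θ ^ j - 1) / (θ - 1)) :=
        (abs_sub_le _ (φ (r ^ j * v)) _).trans (add_le_add h1 (hφj j))
    _ ≤ C * (θ ^ j * g v) + C * g v * (θ ^ j * (1 / (θ - 1))) := by gcongr
    _ = C * (1 + 1 / (θ - 1)) * g v * θ ^ j := by ring
    _ ≤ _ := by
      have : 0 < θ - 1 := by linarith
      gcongr

/-! ### The joint law of the lowest order statistics of a uniform sample -/

/-- The uniform distribution on `(0, 1)`. -/
noncomputable def unifMeasure : Measure ℝ := volume.restrict (Set.Ioo (0 : ℝ) 1)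

instance : IsProbabilityMeasure unifMeasure := ⟨by simp [unifMeasure]⟩

lemma ae_unifMeasure_mem : ∀ᵐ u ∂unifMeasure, u ∈ Set.Ioo (0 : ℝ) 1 :=
  ae_restrict_mem measurableSet_Ioo

/-- The vector `x` rearranged in increasing order. -/
noncomputable def sortedTuple {n : ℕ} (x : Fin n → ℝ) : Fin n → ℝ := x ∘ Tuple.sort x

lemma monotone_sortedTuple {n : ℕ} (x : Fin n → ℝ) : Monotone (sortedTuple x) :=
  Tuple.monotone_sort x

lemma strictMono_sortedTuple {n : ℕ} {x : Fin n → ℝ} (hx : Function.Injective x) :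
    StrictMono (sortedTuple x) :=
  (monotone_sortedTuple x).strictMono_of_injective (hx.comp (Tuple.sort x).injective)

lemma measurable_sortedTuple (n : ℕ) : Measurable (sortedTuple : (Fin n → ℝ) → Fin n → ℝ) := by
  have hsort : ∀ σ : Equiv.Perm (Fin n), MeasurableSet {x : Fin n → ℝ | Tuple.sort x = σ} := by
    intro σ
    simp only [eq_comm (b := σ), Tuple.eq_sort_iff, Monotone, Function.comp_apply]
    refine MeasurableSet.inter ?_ ?_
    · change MeasurableSet {x : Fin n → ℝ | ∀ i j : Fin n, i ≤ j → x (σ i) ≤ x (σ j)}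
      simp only [Set.ofPred_forall]
      exact MeasurableSet.iInter fun i => MeasurableSet.iInter fun j => MeasurableSet.iInter fun _ =>
        measurableSet_le (measurable_pi_apply _) (measurable_pi_apply _)
    · change MeasurableSet
        {x : Fin n → ℝ | ∀ i j : Fin n, i < j → x (σ i) = x (σ j) → σ i < σ j}
      simp only [Set.ofPred_forall]
      refine MeasurableSet.iInter fun i => MeasurableSet.iInter fun j => MeasurableSet.iInter fun _ =>
        ?_
      by_cases h : σ i < σ j
      · simp [h]
      · have h1 : Measurable fun x : Fin n → ℝ => x (σ i) := measurable_pi_apply _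
        have h2 : Measurable fun x : Fin n → ℝ => x (σ j) := measurable_pi_apply _
        simp only [h, imp_false]
        exact (measurableSet_eq_fun h1 h2).compl
  refine measurable_pi_lambda _ fun i => ?_
  intro s hs
  have : (fun x : Fin n → ℝ => sortedTuple x i) ⁻¹' s
      = ⋃ σ : Equiv.Perm (Fin n), {x | Tuple.sort x = σ} ∩ (fun x => x (σ i)) ⁻¹' s := by
    ext x; simp [sortedTuple]
  rw [this]
  exact MeasurableSet.iUnion fun σ => (hsort σ).inter (measurable_pi_apply _ hs)

lemma orderStat_eq_sortedTuple (x : ℕ → ℝ) {n i : ℕ} (h : i < n) :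
    TailIndex.orderStat x n (i + 1) = sortedTuple (fun j : Fin n => x j) ⟨i, h⟩ := by
  have : 1 ≤ i + 1 ∧ i + 1 ≤ n := ⟨by omega, by omega⟩
  simp [TailIndex.orderStat, this, sortedTuple]

/-- If exactly `k` coordinates of `x` lie strictly below `t`, the product of `e (x i) t` over these
coordinates; otherwise `0`. -/
noncomputable def belowProd {n : ℕ} (e : ℝ → ℝ → ℂ) (k : ℕ) (x : Fin n → ℝ) (t : ℝ) : ℂ :=
  if (∑ i, if x i < t then 1 else 0) = k then ∏ i, (if x i < t then e (x i) t else 1) else 0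

lemma belowProd_comp_equiv {n : ℕ} (e : ℝ → ℝ → ℂ) (k : ℕ) (x : Fin n → ℝ) (t : ℝ)
    (σ : Equiv.Perm (Fin n)) : belowProd e k (x ∘ σ) t = belowProd e k x t := by
  unfold belowProd
  simp only [Function.comp_apply]
  rw [Equiv.sum_comp σ (fun i => if x i < t then 1 else 0),
    Equiv.prod_comp σ (fun i => if x i < t then e (x i) t else 1)]

/-- For a sample without ties, exactly one observation has `k` observations below it: the order
statistic of rank `k + 1`. -/
lemma sum_belowProd {n : ℕ} (e : ℝ → ℝ → ℂ) {k : ℕ} (hk : k < n) {x : Fin n → ℝ}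
    (hx : Function.Injective x) :
    ∑ j, belowProd e k x (x j) =
      ∏ i : Fin k, e (sortedTuple x (i.castLE hk.le)) (sortedTuple x ⟨k, hk⟩) := by
  have hs := strictMono_sortedTuple hx
  rw [← Equiv.sum_comp (Tuple.sort x)]
  have hterm : ∀ l : Fin n, belowProd e k x (x (Tuple.sort x l)) =
      if (l : ℕ) = k then ∏ i ∈ Finset.Iio l, e (sortedTuple x i) (sortedTuple x l) else 0 := by
    intro l
    rw [← belowProd_comp_equiv e k x _ (Tuple.sort x)]
    have hlt : ∀ i, (x ∘ Tuple.sort x) i < x (Tuple.sort x l) ↔ i < l := fun i =>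
      hs.lt_iff_lt (a := i) (b := l)
    unfold belowProd
    simp only [hlt]
    rw [Finset.sum_boole, Finset.prod_ite]
    have hf : Finset.univ.filter (fun i => i < l) = Finset.Iio l := by ext; simp
    simp only [hf, Fin.card_Iio, Nat.cast_id, Finset.prod_const_one, mul_one]
    rfl
  simp only [hterm]
  rw [Finset.sum_eq_single (⟨k, hk⟩ : Fin n)]
  · rw [if_pos rfl]
    refine (Finset.prod_bij (fun (i : Fin k) _ => i.castLE hk.le) ?_ ?_ ?_ ?_).symm
    · intro i _; simp [Fin.lt_def]
    · intro i _ j _ h; simpa using h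
    · intro b hb
      exact ⟨⟨b, by simpa [Fin.lt_def] using hb⟩, Finset.mem_univ _, rfl⟩
    · intro i _; rfl
  · intro l _ hl
    rw [if_neg]
    exact fun h => hl (Fin.ext h)
  · simp

lemma measurable_belowProd {n : ℕ} {e : ℝ → ℝ → ℂ} (he : Measurable (Function.uncurry e)) (k : ℕ) :
    Measurable (fun z : ℝ × (Fin n → ℝ) => belowProd e k z.2 z.1) := by
  have hlt : ∀ i : Fin n, MeasurableSet {z : ℝ × (Fin n → ℝ) | z.2 i < z.1} := fun i =>
    measurableSet_lt (by fun_prop) (by fun_prop)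
  unfold belowProd
  refine Measurable.ite ?_ ?_ measurable_const
  · have : Measurable (fun z : ℝ × (Fin n → ℝ) => ∑ i, if z.2 i < z.1 then 1 else 0) :=
      Finset.measurable_sum _ fun i _ => Measurable.ite (hlt i) measurable_const measurable_const
    exact this (measurableSet_singleton k)
  · refine Finset.measurable_prod _ fun i _ => Measurable.ite (hlt i) ?_ measurable_const
    exact he.comp ((by fun_prop : Measurable fun z : ℝ × (Fin n → ℝ) => (z.2 i, z.1)))

lemma norm_belowProd_le {n : ℕ} {e : ℝ → ℝ → ℂ} (he1 : ∀ u w, ‖e u w‖ ≤ 1) (k : ℕ)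
    (x : Fin n → ℝ) (t : ℝ) : ‖belowProd e k x t‖ ≤ 1 := by
  unfold belowProd
  split_ifs
  · rw [norm_prod]
    refine Finset.prod_le_one (fun _ _ => norm_nonneg _) fun i _ => ?_
    split_ifs
    · exact he1 _ _
    · simp
  · simp

/-- Expansion of `belowProd` over the possible sets of the `k` coordinates lying below `t`. -/
lemma belowProd_eq_sum {n : ℕ} (e : ℝ → ℝ → ℂ) (k : ℕ) (x : Fin n → ℝ) (t : ℝ) :
    belowProd e k x t = ∑ A ∈ Finset.powersetCard k (Finset.univ : Finset (Fin n)),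
      ∏ i, (if i ∈ A then (if x i < t then e (x i) t else 0) else (if x i < t then 0 else 1)) := by
  set A₀ : Finset (Fin n) := Finset.univ.filter (fun i => x i < t) with hA₀
  have hterm : ∀ A : Finset (Fin n), A ≠ A₀ →
      ∏ i, (if i ∈ A then (if x i < t then e (x i) t else 0) else (if x i < t then 0 else 1)) = 0 := by
    intro A hA
    obtain ⟨i, hi⟩ : ∃ i, ¬ (i ∈ A ↔ x i < t) := by
      by_contra! h
      exact hA (by ext i; simp [hA₀, h i])
    refine Finset.prod_eq_zero (Finset.mem_univ i) ?_
    by_cases h1 : i ∈ A <;> by_cases h2 : x i < t <;> simp_all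
  have hA₀term : ∏ i, (if i ∈ A₀ then (if x i < t then e (x i) t else 0)
      else (if x i < t then 0 else 1)) = ∏ i, (if x i < t then e (x i) t else 1) := by
    refine Finset.prod_congr rfl fun i _ => ?_
    by_cases h2 : x i < t <;> simp [hA₀, h2]
  unfold belowProd
  rw [Finset.sum_boole]
  by_cases hc : A₀.card = k
  · rw [Finset.sum_eq_single A₀ (fun A _ hA => hterm A hA), hA₀term, if_pos (by simpa using hc)]
    intro h
    exact absurd (Finset.mem_powersetCard.2 ⟨Finset.subset_univ _, hc⟩) h
  · rw [Finset.sum_eq_zero, if_neg (by simpa using hc)]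
    intro A hA
    refine hterm A ?_
    rintro rfl
    exact hc (Finset.mem_powersetCard.1 hA).2

lemma integral_unifMeasure_ite_lt (f : ℝ → ℂ) {w : ℝ} (hw : w ∈ Set.Ioo (0 : ℝ) 1) :
    ∫ u, (if u < w then f u else 0) ∂unifMeasure = w * ∫ v, f (w * v) ∂unifMeasure := by
  have h1 : ∫ u, (if u < w then f u else 0) ∂unifMeasure = ∫ u in (0 : ℝ)..w, f u := by
    have : (fun u => if u < w then f u else 0) = (Set.Iio w).indicator f := by
      ext u; simp [Set.indicator_apply]
    rw [this, integral_indicator measurableSet_Iio, unifMeasure, Measure.restrict_restrict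
      measurableSet_Iio, intervalIntegral.integral_of_le hw.1.le, integral_Ioc_eq_integral_Ioo]
    congr 2
    ext u
    simp only [Set.mem_inter_iff, Set.mem_Iio, Set.mem_Ioo]
    constructor
    · rintro ⟨a, b, c⟩; exact ⟨b, a⟩
    · rintro ⟨a, b⟩; exact ⟨b, a, b.trans hw.2⟩
  have h2 : ∫ v, f (w * v) ∂unifMeasure = ∫ v in (0 : ℝ)..1, f (w * v) := by
    rw [unifMeasure, intervalIntegral.integral_of_le zero_le_one, integral_Ioc_eq_integral_Ioo]
  rw [h1, h2, intervalIntegral.integral_comp_mul_left _ hw.1.ne']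
  simp only [mul_zero, mul_one, Complex.real_smul, Complex.ofReal_inv]
  rw [mul_inv_cancel_left₀]
  exact_mod_cast hw.1.ne'

lemma integral_unifMeasure_ite_ge {w : ℝ} (hw : w ∈ Set.Ioo (0 : ℝ) 1) :
    ∫ u, (if u < w then (0 : ℂ) else 1) ∂unifMeasure = 1 - w := by
  have h : ∀ u, (if u < w then (0 : ℂ) else 1) = 1 - (if u < w then (1 : ℂ) else 0) := by
    intro u; split_ifs <;> simp
  simp only [h]
  rw [integral_sub (integrable_const _), integral_unifMeasure_ite_lt _ hw]
  · simp
  · refine Integrable.of_bound (C := 1) ?_ (ae_of_all _ fun u => ?_)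
    · exact (Measurable.ite measurableSet_Iio measurable_const measurable_const).aestronglyMeasurable
    · split_ifs <;> simp

/-- Given the threshold `w`, the number of observations below it is binomial, and those below
it are independent and uniform on `(0, w)`. -/
lemma integral_belowProd {e : ℝ → ℝ → ℂ} (he : Measurable (Function.uncurry e))
    (he1 : ∀ u w, ‖e u w‖ ≤ 1) (m k : ℕ) {w : ℝ} (hw : w ∈ Set.Ioo (0 : ℝ) 1) :
    ∫ x : Fin m → ℝ, belowProd e k x w ∂(Measure.pi fun _ => unifMeasure) =
      m.choose k * (w * ∫ v, e (w * v) w ∂unifMeasure) ^ k * (1 - w) ^ (m - k) := by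
  simp only [belowProd_eq_sum]
  have hew : Measurable (fun u => e u w) := he.comp (by fun_prop : Measurable fun u : ℝ => (u, w))
  rw [integral_finsetSum]
  · have : ∀ A ∈ Finset.powersetCard k (Finset.univ : Finset (Fin m)),
        ∫ x : Fin m → ℝ, ∏ i, (if i ∈ A then (if x i < w then e (x i) w else 0)
          else (if x i < w then 0 else 1)) ∂(Measure.pi fun _ => unifMeasure) =
        (w * ∫ v, e (w * v) w ∂unifMeasure) ^ k * (1 - w) ^ (m - k) := by
      intro A hA
      have hA' := (Finset.mem_powersetCard.1 hA).2
      rw [integral_fintype_prod_eq_prod (fun (i : Fin m) (u : ℝ) =>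
        (if i ∈ A then (if u < w then e u w else 0) else (if u < w then (0 : ℂ) else 1)))]
      have : ∀ i : Fin m, ∫ u, (if i ∈ A then (if u < w then e u w else 0)
          else (if u < w then (0 : ℂ) else 1)) ∂unifMeasure =
          if i ∈ A then (w * ∫ v, e (w * v) w ∂unifMeasure) else (1 - w : ℂ) := by
        intro i
        by_cases hi : i ∈ A
        · simp only [hi, if_true, integral_unifMeasure_ite_lt _ hw]
        · simp only [hi, if_false, integral_unifMeasure_ite_ge hw]
      simp only [this]
      rw [Finset.prod_ite, Finset.prod_const, Finset.prod_const]
      congr 2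
      · rw [← hA']; congr 1; ext; simp
      · rw [Finset.filter_not, Finset.card_sdiff_of_subset (Finset.filter_subset _ _)]
        simp [hA']
    rw [Finset.sum_congr rfl this]
    simp [mul_assoc]
  · intro A _
    refine Integrable.of_bound (C := 1) ?_ (ae_of_all _ fun x => ?_)
    · refine (Finset.measurable_prod _ fun i _ => ?_).aestronglyMeasurable
      have hlt : MeasurableSet {x : Fin m → ℝ | x i < w} :=
        measurableSet_lt (by fun_prop) measurable_const
      by_cases hi : i ∈ A
      · simp only [hi, if_true]
        exact Measurable.ite hlt (hew.comp (measurable_pi_apply i)) measurable_const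
      · simp only [hi, if_false]
        exact Measurable.ite hlt measurable_const measurable_const
    · rw [norm_prod]
      refine Finset.prod_le_one (fun _ _ => norm_nonneg _) fun i _ => ?_
      split_ifs <;> simp [he1]

lemma ae_injective_pi_unifMeasure (n : ℕ) :
    ∀ᵐ x ∂(Measure.pi fun _ : Fin n => unifMeasure), Function.Injective x := by
  have h : ∀ i j : Fin n, i ≠ j → ∀ᵐ x ∂(Measure.pi fun _ : Fin n => unifMeasure), x i ≠ x j := by
    intro i j hij
    -- a tie is a point of a proper linear subspace
    let s : Submodule ℝ (Fin n → ℝ) := LinearMap.ker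
      (LinearMap.proj (R := ℝ) (φ := fun _ : Fin n => ℝ) i - LinearMap.proj j)
    have hs : s ≠ ⊤ := by
      intro h
      have : Pi.single i (1 : ℝ) ∈ s := h ▸ Submodule.mem_top
      simp [s, hij.symm] at this
    have hpi : (Measure.pi fun _ : Fin n => unifMeasure) =
        volume.restrict (Set.univ.pi fun _ => Set.Ioo (0 : ℝ) 1) := by
      rw [volume_pi, Measure.restrict_pi_pi]; rfl
    rw [hpi]
    refine ae_restrict_of_ae ?_
    rw [ae_iff]
    have hset : {x : Fin n → ℝ | ¬ x i ≠ x j} = (s : Set (Fin n → ℝ)) := by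
      ext x
      simp [s, sub_eq_zero]
    rw [hset]
    exact Measure.addHaar_submodule volume s hs
  have h' : ∀ᵐ x ∂(Measure.pi fun _ : Fin n => unifMeasure), ∀ i j, i ≠ j → x i ≠ x j := by
    simp only [ae_all_iff]; exact h
  filter_upwards [h'] with x hx i j hij
  by_contra hne
  exact hx i j hne hij

/-- The order statistic of rank `k + 1` in a uniform sample of size `m + 1` has density
`(m + 1) * m.choose k * w ^ k * (1 - w) ^ (m - k)`; given its value `w`, the product over the `k`
smaller observations integrates as if these were independent and uniform on `(0, w)`. -/
lemma integral_prod_sortedTuple {e : ℝ → ℝ → ℂ} (he : Measurable (Function.uncurry e))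
    (he1 : ∀ u w, ‖e u w‖ ≤ 1) {m k : ℕ} (hk : k < m + 1) :
    ∫ x : Fin (m + 1) → ℝ,
        ∏ i : Fin k, e (sortedTuple x (i.castLE hk.le)) (sortedTuple x ⟨k, hk⟩)
          ∂(Measure.pi fun _ => unifMeasure) =
      (m + 1) * ∫ w, m.choose k * (w * ∫ v, e (w * v) w ∂unifMeasure) ^ k * (1 - w) ^ (m - k)
        ∂unifMeasure := by
  have h1 : ∫ x : Fin (m + 1) → ℝ,
        ∏ i : Fin k, e (sortedTuple x (i.castLE hk.le)) (sortedTuple x ⟨k, hk⟩)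
          ∂(Measure.pi fun _ => unifMeasure) =
      ∫ x : Fin (m + 1) → ℝ, ∑ j, belowProd e k x (x j) ∂(Measure.pi fun _ => unifMeasure) := by
    refine integral_congr_ae ?_
    filter_upwards [ae_injective_pi_unifMeasure (m + 1)] with x hx
    exact (sum_belowProd e hk hx).symm
  have hj : ∀ j : Fin (m + 1), ∫ x : Fin (m + 1) → ℝ, belowProd e k x (x j)
      ∂(Measure.pi fun _ => unifMeasure) = ∫ w, m.choose k *
        (w * ∫ v, e (w * v) w ∂unifMeasure) ^ k * (1 - w) ^ (m - k) ∂unifMeasure := by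
    intro j
    have hmp := (measurePreserving_piFinSuccAbove (fun _ : Fin (m + 1) => unifMeasure) j).symm
    rw [← hmp.integral_comp']
    have hins : ∀ z : ℝ × (Fin m → ℝ),
        belowProd e k ((MeasurableEquiv.piFinSuccAbove (fun _ => ℝ) j).symm z)
          ((MeasurableEquiv.piFinSuccAbove (fun _ => ℝ) j).symm z j) =
        belowProd e k z.2 z.1 := by
      intro z
      have h0 : (MeasurableEquiv.piFinSuccAbove (fun _ => ℝ) j).symm z = j.insertNth z.1 z.2 := rfl
      simp [h0, belowProd, Fin.sum_univ_succAbove _ j, Fin.prod_univ_succAbove _ j]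
    simp only [hins]
    rw [integral_prod]
    · refine integral_congr_ae ?_
      filter_upwards [ae_unifMeasure_mem] with w hw
      exact integral_belowProd he he1 m k hw
    · exact Integrable.of_bound (C := 1) (measurable_belowProd he k).aestronglyMeasurable
        (ae_of_all _ fun z => norm_belowProd_le he1 k _ _)
  rw [h1, integral_finsetSum]
  · rw [Finset.sum_congr rfl (fun j _ => hj j)]
    simp
  · intro j _
    refine Integrable.of_bound (C := 1) ?_ (ae_of_all _ fun z => norm_belowProd_le he1 k _ _)
    exact ((measurable_belowProd he k).comp (by fun_prop :
      Measurable fun x : Fin (m + 1) → ℝ => (x j, x))).aestronglyMeasurable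

/-! ### Concentration of an intermediate uniform order statistic -/

lemma integral_unifMeasure_pow_mul_pow {m k : ℕ} (hk : k ≤ m) :
    ∫ w, w ^ k * (1 - w) ^ (m - k) ∂unifMeasure = 1 / ((m + 1) * m.choose k) := by
  have h := integral_prod_sortedTuple (e := fun _ _ => 1) measurable_const (fun _ _ => by simp)
    (Nat.lt_succ_of_le hk)
  simp only [Finset.prod_const_one, integral_const, probReal_univ, one_smul, mul_one] at h
  have h2 : ∀ w : ℝ, (m.choose k : ℂ) * (w : ℂ) ^ k * (1 - w) ^ (m - k)
      = ((m.choose k * (w ^ k * (1 - w) ^ (m - k)) : ℝ) : ℂ) := by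
    intro w; push_cast; ring
  simp only [h2] at h
  rw [integral_complex_ofReal, integral_const_mul] at h
  have hc : (m.choose k : ℝ) ≠ 0 := by exact_mod_cast (Nat.choose_pos hk).ne'
  rw [eq_div_iff (by positivity)]
  have h3 : (1 : ℝ) = (m + 1) * (m.choose k * ∫ w, w ^ k * (1 - w) ^ (m - k) ∂unifMeasure) := by
    exact_mod_cast h
  linarith

lemma integrable_unifMeasure_of_continuous {f : ℝ → ℝ} (hf : Continuous f) :
    Integrable f unifMeasure :=
  (hf.continuousOn.integrableOn_compact isCompact_Icc).mono_set Set.Ioo_subset_Icc_self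

/-- The mean square deviation from `x` of the order statistic of rank `k + 1` in a uniform sample
of size `m + 1`. -/
lemma integral_sub_sq_mul_density {m k : ℕ} (hk : k ≤ m) (x : ℝ) :
    ∫ w, (m + 1) * m.choose k * (w ^ k * (1 - w) ^ (m - k)) * (w - x) ^ 2 ∂unifMeasure =
      (k + 1) * (k + 2) / ((m + 2) * (m + 3)) - 2 * x * ((k + 1) / (m + 2)) + x ^ 2 := by
  have h0 := integral_unifMeasure_pow_mul_pow hk
  have h1 := integral_unifMeasure_pow_mul_pow (Nat.succ_le_succ hk)
  have h2 := integral_unifMeasure_pow_mul_pow (Nat.succ_le_succ (Nat.succ_le_succ hk))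
  simp only [Nat.succ_eq_add_one, Nat.add_sub_add_right] at h1 h2
  have hexp : ∀ w : ℝ, (m + 1) * m.choose k * (w ^ k * (1 - w) ^ (m - k)) * (w - x) ^ 2 =
      (m + 1) * m.choose k * (w ^ (k + 1 + 1) * (1 - w) ^ (m - k))
      - (m + 1) * m.choose k * (2 * x) * (w ^ (k + 1) * (1 - w) ^ (m - k))
      + (m + 1) * m.choose k * x ^ 2 * (w ^ k * (1 - w) ^ (m - k)) := by
    intro w; ring
  simp only [hexp]
  rw [integral_add (integrable_unifMeasure_of_continuous (by fun_prop))
      (integrable_unifMeasure_of_continuous (by fun_prop)),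
    integral_sub (integrable_unifMeasure_of_continuous (by fun_prop))
      (integrable_unifMeasure_of_continuous (by fun_prop)),
    integral_const_mul, integral_const_mul, integral_const_mul, h0, h1, h2]
  have c1 : ((m : ℝ) + 1) * m.choose k = (m + 1).choose (k + 1) * (k + 1) := by
    exact_mod_cast Nat.add_one_mul_choose_eq m k
  have c2 : ((m : ℝ) + 1 + 1) * (m + 1).choose (k + 1) =
      (m + 1 + 1).choose (k + 1 + 1) * (k + 1 + 1) := by
    exact_mod_cast Nat.add_one_mul_choose_eq (m + 1) (k + 1)
  have p0 : (0 : ℝ) < m.choose k := by exact_mod_cast Nat.choose_pos hk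
  have p1 : (0 : ℝ) < (m + 1).choose (k + 1) := by
    exact_mod_cast Nat.choose_pos (Nat.succ_le_succ hk)
  have p2 : (0 : ℝ) < (m + 1 + 1).choose (k + 1 + 1) := by
    exact_mod_cast Nat.choose_pos (Nat.succ_le_succ (Nat.succ_le_succ hk))
  have e0 : ((m : ℝ) + 1) * m.choose k * x ^ 2 * (1 / ((m + 1) * m.choose k)) = x ^ 2 := by
    field_simp
  have e1 : ((m : ℝ) + 1) * m.choose k * (2 * x) *
      (1 / (((m + 1 : ℕ) + 1) * (m + 1).choose (k + 1))) = 2 * x * ((k + 1) / (m + 2)) := by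
    rw [c1]; push_cast
    have : (m : ℝ) + 1 + 1 = m + 2 := by ring
    rw [this]; field_simp
  have e2 : ((m : ℝ) + 1) * m.choose k *
      (1 / (((m + 1 + 1 : ℕ) + 1) * (m + 1 + 1).choose (k + 1 + 1))) =
      (k + 1) * (k + 2) / ((m + 2) * (m + 3)) := by
    have p3 : ((m + 1).choose (k + 1) : ℝ) =
      (m + 1 + 1).choose (k + 1 + 1) * (k + 1 + 1) / (m + 1 + 1) := by
      rw [eq_div_iff (by positivity)]; linarith
    rw [c1, p3]; push_cast
    have h2 : (m : ℝ) + 1 + 1 = m + 2 := by ring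
    have h3 : (m : ℝ) + 2 + 1 = m + 3 := by ring
    have h4 : (k : ℝ) + 1 + 1 = k + 2 := by ring
    rw [h2, h3, h4]; field_simp
  rw [e0, e1, e2]

/-- If the conditional expectation given the order statistic of rank `k + 1` is within `δ` of `L`
while this order statistic is within `η * x` of `x`, then the expectation is close to `L`. The
complementary event is controlled by Chebyshev's inequality. -/
lemma norm_integral_prod_sortedTuple_sub_le {e : ℝ → ℝ → ℂ}
    (he : Measurable (Function.uncurry e)) (he1 : ∀ u w, ‖e u w‖ ≤ 1) {m k : ℕ} (hk : k < m + 1)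
    {L : ℂ} (hL : ‖L‖ ≤ 1) {δ x η : ℝ} (hδ : 0 ≤ δ) (hx : 0 < x) (hη : 0 < η)
    (h : ∀ w ∈ Set.Ioo (0 : ℝ) 1, |w - x| ≤ η * x →
      ‖(∫ v, e (w * v) w ∂unifMeasure) ^ k - L‖ ≤ δ) :
    ‖(∫ x : Fin (m + 1) → ℝ,
        ∏ i : Fin k, e (sortedTuple x (i.castLE hk.le)) (sortedTuple x ⟨k, hk⟩)
          ∂(Measure.pi fun _ => unifMeasure)) - L‖ ≤
      δ + 2 / (η * x) ^ 2 * ((k + 1) * (k + 2) / ((m + 2) * (m + 3))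
        - 2 * x * ((k + 1) / (m + 2)) + x ^ 2) := by
  have hk' : k ≤ m := Nat.lt_succ_iff.1 hk
  rw [integral_prod_sortedTuple he he1 hk, ← integral_const_mul]
  set D : ℝ → ℝ := fun w => (m + 1) * m.choose k * (w ^ k * (1 - w) ^ (m - k)) with hD
  have hDint : ∫ w, D w ∂unifMeasure = 1 := by
    have hc : (m.choose k : ℝ) ≠ 0 := by exact_mod_cast (Nat.choose_pos hk').ne'
    simp only [hD]
    rw [integral_const_mul, integral_unifMeasure_pow_mul_pow hk']
    field_simp
  have hDi : Integrable D unifMeasure := integrable_unifMeasure_of_continuous (by fun_prop)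
  set A : ℝ → ℂ := fun w => (∫ v, e (w * v) w ∂unifMeasure) ^ k with hA
  have hA1 : ∀ w, ‖A w‖ ≤ 1 := by
    intro w
    simp only [hA, norm_pow]
    refine pow_le_one₀ (norm_nonneg _) ?_
    refine (norm_integral_le_of_norm_le_const (C := 1) (ae_of_all _ fun v => he1 _ _)).trans ?_
    simp
  have hAm : Measurable A := by
    have : Measurable (Function.uncurry fun (w v : ℝ) => e (w * v) w) :=
      he.comp (by fun_prop : Measurable fun z : ℝ × ℝ => (z.1 * z.2, z.1))
    exact (this.stronglyMeasurable.integral_prod_right').measurable.pow_const k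
  have hLint : (L : ℂ) = ∫ w, (D w : ℂ) * L ∂unifMeasure := by
    rw [integral_mul_const, integral_complex_ofReal, hDint]; simp
  have hDc : Integrable (fun w => (D w : ℂ)) unifMeasure := hDi.ofReal
  have hDA : Integrable (fun w => (D w : ℂ) * A w) unifMeasure := by
    simp only [mul_comm (_ : ℂ) (A _)]
    exact hDc.bdd_mul hAm.aestronglyMeasurable (ae_of_all _ hA1)
  have hrew : ∀ w : ℝ, ((m : ℂ) + 1) * (m.choose k * (w * ∫ v, e (w * v) w ∂unifMeasure) ^ k *
      (1 - w) ^ (m - k)) = (D w : ℂ) * A w := by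
    intro w; simp only [hD, hA]; push_cast; ring
  simp only [hrew]
  rw [hLint, ← integral_sub hDA (hDc.mul_const L)]
  have hmom := integral_sub_sq_mul_density hk' x
  have hi2 : Integrable (fun w => D w * (w - x) ^ 2) unifMeasure :=
    integrable_unifMeasure_of_continuous (by fun_prop)
  have hbound : ∫ w, (δ * D w + 2 / (η * x) ^ 2 * (D w * (w - x) ^ 2)) ∂unifMeasure =
      δ + 2 / (η * x) ^ 2 * ((k + 1) * (k + 2) / ((m + 2) * (m + 3))
        - 2 * x * ((k + 1) / (m + 2)) + x ^ 2) := by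
    rw [integral_add (hDi.const_mul _) (hi2.const_mul _), integral_const_mul δ D,
      integral_const_mul _ (fun w => D w * (w - x) ^ 2), hDint, hmom, mul_one]
  rw [← hbound]
  refine norm_integral_le_of_norm_le ((hDi.const_mul _).add (hi2.const_mul _)) ?_
  filter_upwards [ae_unifMeasure_mem] with w hw
  have hD0 : 0 ≤ D w := by
    have : 0 ≤ 1 - w := by linarith [hw.2]
    have := hw.1.le
    simp only [hD]; positivity
  rw [← mul_sub, norm_mul, Complex.norm_real, Real.norm_of_nonneg hD0]
  have hkey : ‖A w - L‖ ≤ δ + 2 / (η * x) ^ 2 * (w - x) ^ 2 := by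
    by_cases hwx : |w - x| ≤ η * x
    · exact (h w hw hwx).trans (le_add_of_nonneg_right (by positivity))
    · push Not at hwx
      have h1 : (η * x) ^ 2 ≤ (w - x) ^ 2 := by
        rw [← sq_abs (w - x)]; gcongr
      have h2 : (2 : ℝ) ≤ 2 / (η * x) ^ 2 * (w - x) ^ 2 := by
        rw [div_mul_eq_mul_div, le_div_iff₀ (by positivity)]; linarith
      have := norm_sub_le (A w) L
      linarith [hA1 w]
  calc D w * ‖A w - L‖ ≤ D w * (δ + 2 / (η * x) ^ 2 * (w - x) ^ 2) := by gcongr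
    _ = _ := by ring

/-- The relative mean square deviation of the intermediate order statistic tends to zero. -/
lemma tendsto_relative_variance {k : ℕ → ℕ} (hk : Tendsto k atTop atTop) :
    Tendsto (fun n : ℕ => (((k n : ℝ) + 1) * (k n + 2) / ((n + 1) * (n + 2))
        - 2 * ((k n : ℝ) / n) * ((k n + 1) / (n + 1)) + ((k n : ℝ) / n) ^ 2) /
          ((k n : ℝ) / n) ^ 2) atTop (𝓝 0) := by
  have hk' : Tendsto (fun n => ((k n : ℝ))⁻¹) atTop (𝓝 0) :=
    tendsto_inv_atTop_zero.comp (tendsto_natCast_atTop_atTop.comp hk)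
  have hn' : Tendsto (fun n : ℕ => ((n : ℝ))⁻¹) atTop (𝓝 0) :=
    tendsto_inv_atTop_zero.comp tendsto_natCast_atTop_atTop
  have hlim : Tendsto (fun n : ℕ => (1 + ((k n : ℝ))⁻¹) * (1 + 2 * ((k n : ℝ))⁻¹) /
      ((1 + (n : ℝ)⁻¹) * (1 + 2 * (n : ℝ)⁻¹)) -
      2 * ((1 + ((k n : ℝ))⁻¹) / (1 + (n : ℝ)⁻¹)) + 1) atTop
      (𝓝 ((1 + 0) * (1 + 2 * 0) / ((1 + 0) * (1 + 2 * 0)) - 2 * ((1 + 0) / (1 + 0)) + 1)) := by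
    refine ((Tendsto.div (Tendsto.mul (hk'.const_add 1) ((hk'.const_mul 2).const_add 1))
      (Tendsto.mul (hn'.const_add 1) ((hn'.const_mul 2).const_add 1)) (by norm_num)).sub
      ((Tendsto.div (hk'.const_add 1) (hn'.const_add 1) (by norm_num)).const_mul 2)).add_const 1
  norm_num at hlim
  refine hlim.congr' ?_
  filter_upwards [hk.eventually_ge_atTop 1, eventually_ge_atTop 1] with n h1 h2
  have h1' : (0 : ℝ) < k n := by exact_mod_cast h1
  have h2' : (0 : ℝ) < n := by exact_mod_cast h2
  field_simp

/-! ### Powers of the exponential variable `-γ log v`, for `v` uniform -/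

lemma abs_rpow_sub_rpow_le_of_le_one {x y p : ℝ} (hx : 0 < x) (hy : 0 ≤ y) (hp : 0 < p)
    (hp1 : p ≤ 1) : |y ^ p - x ^ p| ≤ |y - x| * x ^ (p - 1) := by
  have key : ∀ z : ℝ, 0 ≤ z → |z ^ p - 1| ≤ |z - 1| := by
    intro z hz
    rcases le_total z 1 with h | h
    · have h1 : z ^ p ≤ 1 := Real.rpow_le_one hz h hp.le
      have h2 : z ≤ z ^ p := by
        rcases hz.eq_or_lt with rfl | hz
        · simp [Real.zero_rpow hp.ne']
        · simpa using Real.rpow_le_rpow_of_exponent_ge hz h hp1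
      rw [abs_of_nonpos (by linarith), abs_of_nonpos (by linarith)]; linarith
    · have h1 : 1 ≤ z ^ p := Real.one_le_rpow h hp.le
      have h2 : z ^ p ≤ z := by simpa using Real.rpow_le_rpow_of_exponent_le h hp1
      rw [abs_of_nonneg (by linarith), abs_of_nonneg (by linarith)]; linarith
  have h := key (y / x) (by positivity)
  rw [Real.div_rpow hy hx.le, div_sub_one (by positivity), div_sub_one hx.ne', abs_div, abs_div,
    abs_of_pos hx, abs_of_pos (Real.rpow_pos_of_pos hx p),
    div_le_div_iff₀ (by positivity) hx] at h
  rw [Real.rpow_sub_one hx.ne', mul_div_assoc', le_div_iff₀ hx]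
  exact h

lemma abs_rpow_sub_rpow_le_of_one_le {x y p : ℝ} (hx : 0 < x) (hy : 0 ≤ y) (hp : 1 ≤ p) :
    |y ^ p - x ^ p| ≤ p * |y - x| * (max x y) ^ (p - 1) := by
  -- Bernoulli's inequality, applied to the quotient of the smaller by the larger number
  have key : ∀ a b : ℝ, 0 ≤ a → a ≤ b → 0 < b → b ^ p - a ^ p ≤ p * (b - a) * b ^ (p - 1) := by
    intro a b ha hab hb
    have h1 : 0 ≤ a / b := by positivity
    have h2 := one_add_mul_self_le_rpow_one_add (s := a / b - 1) (by linarith) hp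
    rw [add_sub_cancel, Real.div_rpow ha hb.le, le_div_iff₀ (by positivity)] at h2
    rw [Real.rpow_sub_one hb.ne']
    have h3 : p * (b - a) * (b ^ p / b) = - (p * (a / b - 1) * b ^ p) := by
      field_simp; ring
    rw [h3]; linarith
  rcases le_total x y with h | h
  · have hxy : x ^ p ≤ y ^ p := Real.rpow_le_rpow hx.le h (by linarith)
    rw [max_eq_right h, abs_of_nonneg (by linarith), abs_of_nonneg (by linarith)]
    exact key x y hx.le h (hx.trans_le h)
  · have hxy : y ^ p ≤ x ^ p := Real.rpow_le_rpow hy h (by linarith)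
    rw [max_eq_left h, abs_of_nonpos (by linarith), abs_of_nonpos (by linarith), neg_sub, neg_sub]
    exact key y x hy h hx

lemma image_exp_neg_Ioi : (fun x : ℝ => Real.exp (-x)) '' Set.Ioi 0 = Set.Ioo 0 1 := by
  ext v
  constructor
  · rintro ⟨x, hx, rfl⟩
    exact ⟨Real.exp_pos _, Real.exp_lt_one_iff.2 (by simpa using hx)⟩
  · rintro ⟨h0, h1⟩
    exact ⟨-Real.log v, by simpa using Real.log_neg h0 h1, by simp [Real.exp_log h0]⟩

lemma hasDerivAt_exp_neg (x : ℝ) :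
    HasDerivAt (fun x : ℝ => Real.exp (-x)) (-Real.exp (-x)) x := by
  simpa using (hasDerivAt_neg x).exp

/-- The uniform distribution is the image under `x ↦ exp (-x)` of the exponential one. -/
lemma integral_unifMeasure_eq_exp (f : ℝ → ℝ) :
    ∫ v, f v ∂unifMeasure = ∫ x in Set.Ioi (0 : ℝ), Real.exp (-x) * f (Real.exp (-x)) := by
  rw [unifMeasure, ← image_exp_neg_Ioi, integral_image_eq_integral_abs_deriv_smul measurableSet_Ioi
    (fun x _ => (hasDerivAt_exp_neg x).hasDerivWithinAt)
    (fun x _ y _ h => by simpa using h)]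
  simp

lemma integrable_unifMeasure_iff_exp (f : ℝ → ℝ) :
    Integrable f unifMeasure ↔
      IntegrableOn (fun x => Real.exp (-x) * f (Real.exp (-x))) (Set.Ioi 0) := by
  have := integrableOn_image_iff_integrableOn_abs_deriv_smul (F := ℝ) (measurableSet_Ioi (a := (0:ℝ)))
    (fun x _ => (hasDerivAt_exp_neg x).hasDerivWithinAt)
    (fun x _ y _ h => by simpa using h) f
  rw [image_exp_neg_Ioi] at this
  simpa [IntegrableOn, unifMeasure] using this

lemma integrable_rpow_mul_neg_log_rpow {ε s : ℝ} (hε : ε < 1) (hs : -1 < s) :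
    Integrable (fun v => v ^ (-ε) * (-Real.log v) ^ s) unifMeasure := by
  rw [integrable_unifMeasure_iff_exp]
  have h := integrableOn_rpow_mul_exp_neg_mul_rpow (p := 1) hs one_pos (b := 1 - ε) (by linarith)
  refine h.congr_fun (fun x _ => ?_) measurableSet_Ioi
  simp only [Real.log_exp, neg_neg, Real.rpow_one, ← Real.exp_mul]
  rw [← mul_assoc, ← Real.exp_add, mul_comm]
  ring_nf

lemma integral_neg_log_rpow {γ p : ℝ} (hγ : 0 < γ) (hp : 0 < p) :
    Integrable (fun v => (-γ * Real.log v) ^ p) unifMeasure ∧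
      ∫ v, (-γ * Real.log v) ^ p ∂unifMeasure = γ ^ p * Real.Gamma (p + 1) := by
  have hrw : (fun v => (-γ * Real.log v) ^ p) =ᵐ[unifMeasure]
      fun v => γ ^ p * (-Real.log v) ^ p := by
    filter_upwards [ae_unifMeasure_mem] with v hv
    rw [neg_mul, ← mul_neg, Real.mul_rpow hγ.le (by linarith [Real.log_neg hv.1 hv.2])]
  constructor
  · refine Integrable.congr ?_ hrw.symm
    have := integrable_rpow_mul_neg_log_rpow (ε := 0) (s := p) (by norm_num) (by linarith)
    simp only [neg_zero, Real.rpow_zero, one_mul] at this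
    exact this.const_mul _
  · rw [integral_congr_ae hrw, integral_const_mul, integral_unifMeasure_eq_exp,
      Real.Gamma_eq_integral (by linarith)]
    simp

/-- The error in `(-γ log v) ^ p` caused by a perturbation of size `η * v ^ (-ε)` of the base is
at most `η` times a fixed integrable function. For `p < 1` that function blows up at `v = 1`, where
the base vanishes. -/
lemma exists_integrable_bound_rpow_sub {γ p : ℝ} (hγ : 0 < γ) (hp : 0 < p) :
    ∃ ε : ℝ, 0 < ε ∧ ∃ Ψ : ℝ → ℝ, Integrable Ψ unifMeasure ∧
      ∀ v ∈ Set.Ioo (0 : ℝ) 1, ∀ η ∈ Set.Icc (0 : ℝ) 1,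
      ∀ y : ℝ, 0 ≤ y → |y - -γ * Real.log v| ≤ η * v ^ (-ε) →
        |y ^ p - (-γ * Real.log v) ^ p| ≤ η * Ψ v := by
  rcases le_total p 1 with hp1 | hp1
  · refine ⟨1 / 2, by norm_num,
      fun v => γ ^ (p - 1) * (v ^ (-(1 / 2 : ℝ)) * (-Real.log v) ^ (p - 1)),
      (integrable_rpow_mul_neg_log_rpow (by norm_num) (by linarith)).const_mul _, ?_⟩
    intro v hv η hη y hy h
    have hl := Real.log_neg hv.1 hv.2
    have hx : 0 < -γ * Real.log v := by nlinarith
    refine (abs_rpow_sub_rpow_le_of_le_one hx hy hp hp1).trans ?_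
    have h1 : (-γ * Real.log v) ^ (p - 1) = γ ^ (p - 1) * (-Real.log v) ^ (p - 1) := by
      rw [neg_mul, ← mul_neg, Real.mul_rpow hγ.le (by linarith)]
    have h2 : 0 ≤ (-Real.log v) ^ (p - 1) := Real.rpow_nonneg (by linarith) _
    rw [h1]
    calc |y - -γ * Real.log v| * (γ ^ (p - 1) * (-Real.log v) ^ (p - 1))
        ≤ η * v ^ (-(1 / 2 : ℝ)) * (γ ^ (p - 1) * (-Real.log v) ^ (p - 1)) := by gcongr
      _ = _ := by ring
  · -- then `v ^ (-ε * p) = v ^ (-1 / 2)`, and `-log v` is at most a multiple of `v ^ (-ε)`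
    set ε : ℝ := 1 / (2 * p) with hε
    have hε0 : 0 < ε := by positivity
    refine ⟨ε, hε0, fun v => p * (1 + γ / ε) ^ (p - 1) * v ^ (-(1 / 2 : ℝ)), ?_, ?_⟩
    · have := integrable_rpow_mul_neg_log_rpow (ε := 1 / 2) (s := 0) (by norm_num) (by norm_num)
      simp only [Real.rpow_zero, mul_one] at this
      exact this.const_mul _
    intro v hv η hη y hy h
    have hl := Real.log_neg hv.1 hv.2
    have hx : 0 < -γ * Real.log v := by nlinarith
    refine (abs_rpow_sub_rpow_le_of_one_le hx hy hp1).trans ?_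
    have hV : 0 < v ^ (-ε) := Real.rpow_pos_of_pos hv.1 _
    have h1 : -Real.log v ≤ v ^ (-ε) / ε := by
      have := Real.log_le_rpow_div (x := v⁻¹) (by have := hv.1; positivity) hε0
      rwa [Real.log_inv, Real.inv_rpow hv.1.le, ← Real.rpow_neg hv.1.le] at this
    have h2 : -γ * Real.log v ≤ γ / ε * v ^ (-ε) := by
      calc -γ * Real.log v = γ * -Real.log v := by ring
        _ ≤ γ * (v ^ (-ε) / ε) := by gcongr
        _ = _ := by ring
    have h3 : max (-γ * Real.log v) y ≤ (1 + γ / ε) * v ^ (-ε) := by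
      refine max_le (by nlinarith) ?_
      have h4 : η * v ^ (-ε) ≤ v ^ (-ε) := mul_le_of_le_one_left hV.le hη.2
      have := le_abs_self (y - -γ * Real.log v)
      nlinarith
    calc p * |y - -γ * Real.log v| * max (-γ * Real.log v) y ^ (p - 1)
        ≤ p * (η * v ^ (-ε)) * ((1 + γ / ε) * v ^ (-ε)) ^ (p - 1) := by
          gcongr
          exact mul_nonneg hp.le (mul_nonneg hη.1 hV.le)
      _ = η * (p * (1 + γ / ε) ^ (p - 1) * (v ^ (-ε) * (v ^ (-ε)) ^ (p - 1))) := by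
          rw [Real.mul_rpow (by positivity) hV.le]; ring
      _ = _ := by
          congr 2
          rw [← Real.rpow_one_add' hV.le (by linarith), ← Real.rpow_mul hv.1.le]
          congr 1
          rw [hε]; field_simp; ring

lemma sigmaSq_eq_integral {γ p : ℝ} (hγ : 0 < γ) (hp : 0 < p) :
    Integrable (fun v => ((-γ * Real.log v) ^ p - γ ^ p * Real.Gamma (p + 1)) ^ 2) unifMeasure ∧
    ∫ v, ((-γ * Real.log v) ^ p - γ ^ p * Real.Gamma (p + 1)) ^ 2 ∂unifMeasure =
      TailIndex.sigmaSq γ p := by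
  obtain ⟨i1, e1⟩ := integral_neg_log_rpow hγ hp
  obtain ⟨i2, e2⟩ := integral_neg_log_rpow hγ (p := 2 * p) (by linarith)
  set c := γ ^ p * Real.Gamma (p + 1) with hc
  have hrw : (fun v => ((-γ * Real.log v) ^ p - c) ^ 2) =ᵐ[unifMeasure]
      fun v => (-γ * Real.log v) ^ (2 * p) - 2 * c * (-γ * Real.log v) ^ p + c ^ 2 := by
    filter_upwards [ae_unifMeasure_mem] with v hv
    have : 0 ≤ -γ * Real.log v := by nlinarith [Real.log_neg hv.1 hv.2]
    rw [mul_comm 2 p, Real.rpow_mul this, Real.rpow_two]; ring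
  have i3 : Integrable (fun v => (-γ * Real.log v) ^ (2 * p) - 2 * c * (-γ * Real.log v) ^ p)
    unifMeasure := i2.sub (i1.const_mul _)
  refine ⟨Integrable.congr (i3.add (integrable_const _)) hrw.symm, ?_⟩
  rw [integral_congr_ae hrw, integral_add i3 (integrable_const _), integral_sub i2
    (i1.const_mul _), integral_const_mul, e1, e2, integral_const, probReal_univ, one_smul,
    TailIndex.sigmaSq, hc, mul_comm 2 p, Real.rpow_mul hγ.le, Real.rpow_two]
  ring

lemma sigmaSq_nonneg {γ p : ℝ} (hγ : 0 < γ) (hp : 0 < p) : 0 ≤ TailIndex.sigmaSq γ p := by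
  rw [← (sigmaSq_eq_integral hγ hp).2]
  exact integral_nonneg fun v => sq_nonneg _

/-- Convergence of characteristic functions in the central limit theorem for a centred square
integrable function on a probability space, of any variance. -/
lemma tendsto_integral_cexp_pow {Ω : Type*} [MeasurableSpace Ω] {P : Measure Ω}
    [IsProbabilityMeasure P] {Z : Ω → ℝ} (hZ : Measurable Z) (hZ0 : ∫ v, Z v ∂P = 0)
    (hZi : Integrable (fun v => Z v ^ 2) P) (t : ℝ) :
    Tendsto (fun k : ℕ => (∫ v, Complex.exp (((√(k : ℝ))⁻¹ * t * Z v : ℝ) * Complex.I) ∂P) ^ k)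
      atTop (𝓝 (Complex.exp ((-(∫ v, Z v ^ 2 ∂P) * t ^ 2 / 2 : ℝ)))) := by
  set V := ∫ v, Z v ^ 2 ∂P with hV
  have hV0 : 0 ≤ V := integral_nonneg fun v => sq_nonneg _
  rcases hV0.eq_or_lt with h | h
  -- with zero variance, `Z` vanishes almost everywhere and cannot be rescaled
  · have hz : ∀ᵐ v ∂P, Z v = 0 := by
      have := (integral_eq_zero_iff_of_nonneg (fun v => sq_nonneg (Z v)) hZi).1 h.symm
      filter_upwards [this] with v hv
      simpa using hv
    have : ∀ k : ℕ, (∫ v, Complex.exp (((√(k : ℝ))⁻¹ * t * Z v : ℝ) * Complex.I) ∂P) ^ k = 1 := by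
      intro k
      have : ∫ v, Complex.exp (((√(k : ℝ))⁻¹ * t * Z v : ℝ) * Complex.I) ∂P = ∫ _, 1 ∂P := by
        refine integral_congr_ae ?_
        filter_upwards [hz] with v hv
        simp [hv]
      rw [this, integral_const, probReal_univ, one_smul, one_pow]
    simp only [this, ← h]
    simp
  · have hs : 0 < √V := Real.sqrt_pos.2 h
    have h1 := tendsto_charFun_inv_sqrt_mul_pow (P := P) (X := fun v => Z v / √V)
      (hZ.div_const _).aemeasurable (by rw [integral_div, hZ0, zero_div]) (by
        simp only [Pi.pow_apply, div_pow, Real.sq_sqrt hV0]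
        rw [integral_div, ← hV, div_self h.ne']) (√V * t)
    have h2 : -(((√V * t : ℝ) : ℂ)) ^ 2 / 2 = ((-V * t ^ 2 / 2 : ℝ) : ℂ) := by
      rw [← Complex.ofReal_pow, mul_pow, Real.sq_sqrt hV0]; push_cast; ring
    rw [h2] at h1
    refine h1.congr fun k => ?_
    rw [charFun_apply_real, integral_map (hZ.div_const _).aemeasurable (by fun_prop)]
    congr 1
    refine integral_congr_ae (ae_of_all _ fun v => ?_)
    have hsc : (((√V : ℝ)) : ℂ) ≠ 0 := by exact_mod_cast hs.ne'
    simp only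
    congr 1
    push_cast
    field_simp

lemma norm_pow_sub_pow_le_of_norm_le_one {a b : ℂ} (ha : ‖a‖ ≤ 1) (hb : ‖b‖ ≤ 1) (k : ℕ) :
    ‖a ^ k - b ^ k‖ ≤ k * ‖a - b‖ := by
  induction k with
  | zero => simp
  | succ k ih =>
    have : a ^ (k + 1) - b ^ (k + 1) = a ^ k * (a - b) + (a ^ k - b ^ k) * b := by ring
    rw [this]
    refine (norm_add_le _ _).trans ?_
    rw [norm_mul, norm_mul, norm_pow]
    have h1 : ‖a‖ ^ k * ‖a - b‖ ≤ ‖a - b‖ :=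
      mul_le_of_le_one_left (norm_nonneg _) (pow_le_one₀ (norm_nonneg _) ha)
    have h2 : ‖a ^ k - b ^ k‖ * ‖b‖ ≤ ‖a ^ k - b ^ k‖ := mul_le_of_le_one_right (norm_nonneg _) hb
    push_cast
    linarith

lemma norm_integral_cexp_le_one {Ω : Type*} [MeasurableSpace Ω] {P : Measure Ω}
    [IsProbabilityMeasure P] (f : Ω → ℝ) : ‖∫ v, Complex.exp (f v * Complex.I) ∂P‖ ≤ 1 := by
  refine (norm_integral_le_of_norm_le_const (C := 1) (ae_of_all _ fun v => ?_)).trans (by simp)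
  rw [Complex.norm_exp_ofReal_mul_I]

lemma norm_integral_cexp_sub_le {Ω : Type*} [MeasurableSpace Ω] {P : Measure Ω}
    [IsProbabilityMeasure P] {f g Ψ : Ω → ℝ} (hf : AEMeasurable f P) (hg : AEMeasurable g P)
    (hΨ : Integrable Ψ P) (h : ∀ᵐ v ∂P, |f v - g v| ≤ Ψ v) :
    ‖(∫ v, Complex.exp (f v * Complex.I) ∂P) - ∫ v, Complex.exp (g v * Complex.I) ∂P‖ ≤
      ∫ v, Ψ v ∂P := by
  have hi : ∀ {f : Ω → ℝ}, AEMeasurable f P →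
      Integrable (fun v => Complex.exp (f v * Complex.I)) P := fun {f} hf =>
    Integrable.of_bound (C := 1) (Complex.measurable_exp.comp_aemeasurable
      ((Complex.measurable_ofReal.comp_aemeasurable hf).mul_const _)).aestronglyMeasurable
      (ae_of_all _ fun v => by rw [Complex.norm_exp_ofReal_mul_I])
  rw [← integral_sub (hi hf) (hi hg)]
  refine norm_integral_le_of_norm_le hΨ ?_
  filter_upwards [h] with v hv
  refine le_trans ?_ hv
  have h1 : Complex.exp (f v * Complex.I) - Complex.exp (g v * Complex.I) =
      Complex.exp (g v * Complex.I) * (Complex.exp (Complex.I * ((f v - g v : ℝ))) - 1) := by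
    rw [mul_sub, ← Complex.exp_add]; push_cast; ring_nf
  rw [h1, norm_mul, Complex.norm_exp_ofReal_mul_I, one_mul]
  exact Real.norm_exp_I_mul_ofReal_sub_one_le

/-! ### The quantile function and order statistics -/

section Quantile

variable (μ : Measure ℝ)

lemma quantile_le_iff {s : ℝ} (hs : s ∈ Set.Ioo (0 : ℝ) 1) (x : ℝ) :
    TailIndex.quantile μ s ≤ x ↔ s ≤ cdf μ x := by
  have hne : {x : ℝ | s ≤ cdf μ x}.Nonempty :=
    ((tendsto_cdf_atTop μ).eventually (le_mem_nhds hs.2)).exists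
  obtain ⟨y, hy⟩ := ((tendsto_cdf_atBot μ).eventually (gt_mem_nhds hs.1)).exists
  have hbdd : BddBelow {x : ℝ | s ≤ cdf μ x} := by
    refine ⟨y, fun z hz => ?_⟩
    by_contra! h
    have := monotone_cdf μ h.le
    linarith [show s ≤ cdf μ z from hz]
  constructor
  · intro h
    have hlt : ∀ z, x < z → s ≤ cdf μ z := by
      intro z hz
      obtain ⟨w, hw, hwz⟩ := exists_lt_of_csInf_lt hne (lt_of_le_of_lt h hz)
      exact le_trans hw (monotone_cdf μ hwz.le)
    have hcont : Tendsto (cdf μ) (𝓝[>] x) (𝓝 (cdf μ x)) :=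
      ((cdf μ).right_continuous x).mono Set.Ioi_subset_Ici_self
    exact ge_of_tendsto hcont (eventually_mem_nhdsWithin.mono fun z hz => hlt z hz)
  · intro h
    exact csInf_le hbdd h

lemma monotoneOn_quantile : MonotoneOn (TailIndex.quantile μ) (Set.Ioo 0 1) := by
  intro s hs t ht hst
  rw [quantile_le_iff μ hs]
  exact hst.trans ((quantile_le_iff μ ht _).1 le_rfl)

lemma measurable_quantile : Measurable (TailIndex.quantile μ) := by
  refine measurable_of_Iic fun x => ?_
  -- off `(0, 1)`, the infimum is over `ℝ` or over `∅` and equals `0`, except possibly at `1`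
  have hout : ∀ s, s ∉ Set.Ioo (0 : ℝ) 1 →
      TailIndex.quantile μ s = if s = 1 then TailIndex.quantile μ 1 else 0 := by
    intro s hs
    split_ifs with h1
    · rw [h1]
    · unfold TailIndex.quantile
      rcases le_or_gt s 0 with h0 | h0
      · have : {x : ℝ | s ≤ cdf μ x} = Set.univ :=
          Set.eq_univ_of_forall fun z => h0.trans (cdf_nonneg μ z)
        rw [this, Real.sInf_univ]
      · have h2 : 1 < s := by
          by_contra! h
          exact hs ⟨h0, lt_of_le_of_ne h h1⟩
        have : {x : ℝ | s ≤ cdf μ x} = ∅ := by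
          refine Set.eq_empty_of_forall_notMem fun z hz => ?_
          have := cdf_le_one μ z
          linarith [show s ≤ cdf μ z from hz]
        rw [this, Real.sInf_empty]
  have hset : TailIndex.quantile μ ⁻¹' Set.Iic x = (Set.Ioo 0 1 ∩ Set.Iic (cdf μ x)) ∪
      ((Set.Ioo 0 1)ᶜ ∩ (fun s : ℝ => if s = 1 then TailIndex.quantile μ 1 else 0) ⁻¹'
        Set.Iic x) := by
    ext s
    by_cases hs : s ∈ Set.Ioo (0 : ℝ) 1
    · simp only [Set.mem_preimage, Set.mem_Iic, quantile_le_iff μ hs, Set.mem_union,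
        Set.mem_inter_iff, hs, true_and, Set.mem_compl_iff, not_true, false_and, or_false]
    · simp only [Set.mem_preimage, Set.mem_Iic, hout s hs, Set.mem_union, Set.mem_inter_iff, hs,
        false_and, Set.mem_compl_iff, not_false_iff, true_and, false_or]
  rw [hset]
  refine (measurableSet_Ioo.inter measurableSet_Iic).union (measurableSet_Ioo.compl.inter ?_)
  exact (Measurable.ite (measurableSet_singleton 1) measurable_const measurable_const)
    measurableSet_Iic

/-- The upper quantile function `s ↦ Q (1 - s)`. -/
noncomputable def upperQuantile (s : ℝ) : ℝ := TailIndex.quantile μ (1 - s)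

lemma measurable_upperQuantile : Measurable (upperQuantile μ) :=
  (measurable_quantile μ).comp (measurable_const.sub measurable_id)

lemma antitoneOn_upperQuantile : AntitoneOn (upperQuantile μ) (Set.Ioo 0 1) :=
  fun s hs t ht hst => monotoneOn_quantile μ ⟨by linarith [ht.2], by linarith [ht.1]⟩
    ⟨by linarith [hs.2], by linarith [hs.1]⟩ (by linarith)

lemma map_upperQuantile [IsProbabilityMeasure μ] : unifMeasure.map (upperQuantile μ) = μ := by
  have : IsProbabilityMeasure (unifMeasure.map (upperQuantile μ)) :=
    Measure.isProbabilityMeasure_map (measurable_upperQuantile μ).aemeasurable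
  refine Measure.ext_of_Iic _ _ fun x => ?_
  rw [Measure.map_apply (measurable_upperQuantile μ) measurableSet_Iic]
  have hset : upperQuantile μ ⁻¹' Set.Iic x =ᵐ[unifMeasure] Set.Ici (1 - cdf μ x) := by
    filter_upwards [ae_unifMeasure_mem] with u hu
    apply propext
    change upperQuantile μ u ≤ x ↔ 1 - cdf μ x ≤ u
    rw [upperQuantile, quantile_le_iff μ ⟨by linarith [hu.2], by linarith [hu.1]⟩]
    constructor <;> intro h <;> linarith
  have h0 := cdf_nonneg μ x
  have h1 := cdf_le_one μ x
  have hIoo : (Set.Ici (1 - cdf μ x) ∩ Set.Ioo 0 1 : Set ℝ) =ᵐ[volume]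
      Set.Ioo (1 - cdf μ x) 1 := by
    have : (Set.Ici (1 - cdf μ x) : Set ℝ) =ᵐ[volume] Set.Ioi (1 - cdf μ x) := Ioi_ae_eq_Ici.symm
    refine (this.inter (ae_eq_refl _)).trans (Eventually.of_forall fun u => ?_)
    apply propext
    change (1 - cdf μ x < u ∧ 0 < u ∧ u < 1) ↔ (1 - cdf μ x < u ∧ u < 1)
    constructor
    · rintro ⟨a, _, c⟩; exact ⟨a, c⟩
    · rintro ⟨a, c⟩; exact ⟨a, by linarith, c⟩
  rw [measure_congr hset, unifMeasure, Measure.restrict_apply measurableSet_Ici,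
    measure_congr hIoo, Real.volume_Ioo, sub_sub_cancel, ofReal_cdf]

end Quantile

/-- An antitone map reverses the order of the order statistics. -/
lemma sortedTuple_comp_antitoneOn {n : ℕ} {q : ℝ → ℝ} {s : Set ℝ} (hq : AntitoneOn q s)
    {x : Fin n → ℝ} (hx : ∀ i, x i ∈ s) (i : Fin n) :
    sortedTuple (q ∘ x) i = q (sortedTuple x i.rev) := by
  have h1 : Monotone ((q ∘ x) ∘ (Fin.revPerm.trans (Tuple.sort x) : Equiv.Perm (Fin n))) := by
    intro a b hab
    exact hq (hx _) (hx _) (monotone_sortedTuple x (Fin.rev_le_rev.2 hab))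
  exact congrFun (Tuple.unique_monotone (Tuple.monotone_sort (q ∘ x)) h1) i

lemma measurable_orderStat (n i : ℕ) :
    Measurable (fun x : ℕ → ℝ => TailIndex.orderStat x n i) := by
  by_cases h : 1 ≤ i ∧ i ≤ n
  · obtain ⟨j, rfl⟩ : ∃ j, i = j + 1 := ⟨i - 1, by omega⟩
    have hj : j < n := by omega
    simp only [orderStat_eq_sortedTuple _ hj]
    have h1 : Measurable fun (x : ℕ → ℝ) (j : Fin n) => x j :=
      measurable_pi_lambda _ fun j => measurable_pi_apply (j : ℕ)
    exact (measurable_pi_apply _).comp ((measurable_sortedTuple n).comp h1)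
  · simp only [TailIndex.orderStat, h, dif_neg, not_false_iff]
    exact measurable_const

lemma powerSum_comp_antitoneOn {q : ℝ → ℝ} {s : Set ℝ} (hq : AntitoneOn q s) (p : ℝ) {k n : ℕ}
    (hkn : k < n) {u : ℕ → ℝ} (hu : ∀ j < n, u j ∈ s) :
    TailIndex.powerSum p k n (fun j => q (u j)) = (k : ℝ)⁻¹ * ∑ i ∈ Finset.Icc 1 k,
      (Real.log (q (TailIndex.orderStat u n i) / q (TailIndex.orderStat u n (k + 1)))) ^ p := by
  have key : ∀ i < n, TailIndex.orderStat (fun j => q (u j)) n (n - i) =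
      q (TailIndex.orderStat u n (i + 1)) := by
    intro i hi
    obtain ⟨l, hl⟩ : ∃ l, n - i = l + 1 := ⟨n - i - 1, by omega⟩
    rw [hl, orderStat_eq_sortedTuple _ (by omega : l < n), orderStat_eq_sortedTuple _ hi]
    have := sortedTuple_comp_antitoneOn hq (x := fun j : Fin n => u j) (fun j => hu j j.2)
      ⟨l, by omega⟩
    have hrev : (⟨l, by omega⟩ : Fin n).rev = ⟨i, hi⟩ := by
      ext; simp only [Fin.val_rev]; omega
    rw [hrev] at this
    exact this
  unfold TailIndex.powerSum
  congr 1
  refine Finset.sum_congr rfl fun i hi => ?_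
  obtain ⟨h1, h2⟩ := Finset.mem_Icc.1 hi
  have e1 : n + 1 - i = n - (i - 1) := by omega
  rw [e1, key _ (by omega), key k hkn, Nat.sub_add_cancel h1]

lemma prod_orderStat_eq {k n : ℕ} (hkn : k < n) (e : ℝ → ℝ → ℂ) (u : ℕ → ℝ) :
    ∏ i ∈ Finset.Icc 1 k, e (TailIndex.orderStat u n i) (TailIndex.orderStat u n (k + 1)) =
      ∏ i : Fin k, e (sortedTuple (fun j : Fin n => u j) (i.castLE hkn.le))
        (sortedTuple (fun j : Fin n => u j) ⟨k, hkn⟩) := by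
  rw [orderStat_eq_sortedTuple _ hkn,
    ← Finset.prod_bij (s := (Finset.univ : Finset (Fin k))) (fun i _ => (i : ℕ) + 1)]
  · intro i _; rw [Finset.mem_Icc]; omega
  · intro i _ j _ h; exact Fin.ext (by simpa using h)
  · intro b hb
    obtain ⟨h1, h2⟩ := Finset.mem_Icc.1 hb
    exact ⟨⟨b - 1, by omega⟩, Finset.mem_univ _, by simp only; omega⟩
  · intro i _
    rw [orderStat_eq_sortedTuple _ (i.2.trans hkn)]
    rfl

lemma measurable_prod_sortedTuple {e : ℝ → ℝ → ℂ} (he : Measurable (Function.uncurry e)) {k n : ℕ}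
    (hkn : k < n) : Measurable (fun x : Fin n → ℝ =>
      ∏ i : Fin k, e (sortedTuple x (i.castLE hkn.le)) (sortedTuple x ⟨k, hkn⟩)) := by
  refine Finset.measurable_prod _ fun i _ => ?_
  have h : ∀ j : Fin n, Measurable (fun x : Fin n → ℝ => sortedTuple x j) := fun j =>
    (measurable_pi_apply j).comp (measurable_sortedTuple n)
  exact he.comp ((h (i.castLE hkn.le)).prodMk (h ⟨k, hkn⟩))

lemma map_fin_eq_pi {Ω : Type*} [MeasurableSpace Ω] {P : Measure Ω} [IsProbabilityMeasure P]
    {ν : Measure ℝ} {X : ℕ → Ω → ℝ} (hX : ∀ i, HasLaw (X i) ν P) (hind : iIndepFun X P) (n : ℕ) :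
    P.map (fun ω (j : Fin n) => X j ω) = Measure.pi fun _ => ν := by
  have h := hind.precomp (g := fun j : Fin n => (j : ℕ)) Fin.val_injective
  rw [iIndepFun_iff_map_fun_eq_pi_map (fun i : Fin n => (hX i).aemeasurable)] at h
  refine h.trans ?_
  congr 1
  ext1 i
  exact (hX i).map_eq

/-! ### The second-order condition -/

lemma abs_log_le_two_mul {z : ℝ} (hz : 1 / 2 ≤ z) : |Real.log z| ≤ 2 * |z - 1| := by
  have hz0 : 0 < z := by linarith
  have h1 := Real.log_le_sub_one_of_pos hz0
  have h2 := Real.log_le_sub_one_of_pos (inv_pos.2 hz0)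
  rw [Real.log_inv] at h2
  have h3 : z⁻¹ - 1 ≤ 2 * |z - 1| := by
    have : z⁻¹ - 1 = (1 - z) * z⁻¹ := by field_simp
    rw [this]
    have h4 : z⁻¹ ≤ 2 := by
      rw [inv_le_comm₀ hz0 two_pos]; linarith
    have h5 : 1 - z ≤ |z - 1| := by rw [abs_sub_comm]; exact le_abs_self _
    calc (1 - z) * z⁻¹ ≤ |z - 1| * z⁻¹ := by gcongr
      _ ≤ |z - 1| * 2 := by gcongr
      _ = _ := mul_comm _ _
  rw [abs_le]
  constructor
  · linarith
  · linarith [le_abs_self (z - 1), abs_nonneg (z - 1)]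

lemma tendsto_mul_left_nhdsGT_zero {u : ℝ} (hu : 0 < u) :
    Tendsto (fun v => u * v) (𝓝[>] 0) (𝓝[>] (0 : ℝ)) := by
  refine tendsto_nhdsWithin_iff.2 ⟨?_, ?_⟩
  · have : Tendsto (fun v : ℝ => u * v) (𝓝 0) (𝓝 (u * 0)) := by
      exact (continuous_const.mul continuous_id).tendsto 0
    rw [mul_zero] at this
    exact this.mono_left nhdsWithin_le_nhds
  · filter_upwards [self_mem_nhdsWithin] with v hv
    exact mul_pos hu hv

/-- The hypotheses on `ℓ` and `a` yield a Potter-type bound for `log ℓ` with respect to `a / ℓ`,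
and local boundedness of the ratios of `a / ℓ`. -/
lemma exists_second_order_bound {ℓ a : ℝ → ℝ} (hℓ : TailIndex.SlowlyVaryingAtZero ℓ)
    (ha : TailIndex.RegularlyVaryingAtZero a)
    (haℓ : Tendsto (fun v => a v / ℓ v) (𝓝[>] 0) (𝓝 0))
    {B : Set ℝ} (hB : MeasurableSet B) (hB01 : B ⊆ Set.Icc 0 1) (hBpos : 0 < volume B)
    (hsecond : ∀ u ∈ B,
      limsup (fun v : ℝ => ((|ℓ (u * v) - ℓ v| / a v : ℝ) : EReal)) (𝓝[>] 0) < ⊤)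
    {ε : ℝ} (hε : 0 < ε) :
    ∃ r ∈ Set.Ioo (0 : ℝ) 1, ∃ C C' s : ℝ, 0 < C ∧ 0 < C' ∧ 0 < s ∧ ∀ v ∈ Set.Ioo 0 s,
      0 < ℓ v ∧ 0 < a v / ℓ v ∧
      (∀ t ∈ Set.Icc r 1, ComparableAt (fun v => Real.log (ℓ v)) (fun v => a v / ℓ v) C v t) ∧
      ∀ t ∈ Set.Ioc (0 : ℝ) 1,
        |Real.log (ℓ (t * v)) - Real.log (ℓ v)| ≤ C' * (a v / ℓ v) * t ^ (-ε) := by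
  obtain ⟨ρ, ⟨δ₂, hδ₂, hapos, ham⟩, har⟩ := ha
  obtain ⟨⟨δ₁, hδ₁, hℓpos, hℓm⟩, hℓr⟩ := hℓ
  set δ := min δ₁ δ₂ with hδ
  have hδ0 : 0 < δ := lt_min hδ₁ hδ₂
  have hs1 : Set.Ioo 0 δ ⊆ Set.Ioo 0 δ₁ := Set.Ioo_subset_Ioo_right (min_le_left _ _)
  have hs2 : Set.Ioo 0 δ ⊆ Set.Ioo 0 δ₂ := Set.Ioo_subset_Ioo_right (min_le_right _ _)
  replace hℓm := hℓm.mono_measure (Measure.restrict_mono hs1 le_rfl)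
  replace ham := ham.mono_measure (Measure.restrict_mono hs2 le_rfl)
  set φ : ℝ → ℝ := fun v => Real.log (ℓ v) with hφ
  set g : ℝ → ℝ := fun v => a v / ℓ v with hg
  have hφm : AEMeasurable φ (volume.restrict (Set.Ioo 0 δ)) :=
    Real.measurable_log.comp_aemeasurable hℓm
  have hgm : AEMeasurable g (volume.restrict (Set.Ioo 0 δ)) := ham.div hℓm
  have hgpos : ∀ v ∈ Set.Ioo 0 δ, 0 < g v := fun v hv => div_pos (hapos v (hs2 hv)) (hℓpos v (hs1 hv))
  have hnhds : Set.Ioo 0 δ ∈ 𝓝[>] (0 : ℝ) := Ioo_mem_nhdsGT hδ0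
  have hgr : ∀ u : ℝ, 0 < u → Tendsto (fun v => g (u * v) / g v) (𝓝[>] 0) (𝓝 (u ^ ρ)) := by
    intro u hu
    have := (har u hu).div (hℓr u hu) (by simp)
    rw [Real.rpow_zero, div_one] at this
    refine this.congr fun v => ?_
    simp only [hg]
    exact div_div_div_comm _ _ _ _
  -- at the end points `0` and `1` of `[0, 1]` the condition carries no information
  set B' := B ∩ Set.Ioo 0 1 with hB'
  have hB'pos : 0 < volume B' := by
    have h1 : B' =ᵐ[volume] B := by
      have h2 : (B ∩ Set.Ioo 0 1 : Set ℝ) =ᵐ[volume] (B ∩ Set.Icc 0 1 : Set ℝ) :=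
        (ae_eq_refl B).inter Ioo_ae_eq_Icc
      rwa [Set.inter_eq_left.2 hB01] at h2
    rwa [measure_congr h1]
  have hpt : ∀ u ∈ B', ∃ C : ℝ, ∀ᶠ v in 𝓝[>] 0, ComparableAt φ g C v u := by
    rintro u ⟨huB, hu0, hu1⟩
    obtain ⟨M, hM, -⟩ := EReal.lt_iff_exists_real_btwn.1 (hsecond u huB)
    have e1 := eventually_lt_of_limsup_lt hM
    have e2 := (hℓr u hu0).eventually (lt_mem_nhds (show (1 / 2 : ℝ) < u ^ (0 : ℝ) by norm_num))
    have hρ := Real.rpow_pos_of_pos hu0 ρ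
    have e3 := (hgr u hu0).eventually (gt_mem_nhds (show u ^ ρ < u ^ ρ + 1 by linarith))
    have e4 := (hgr u hu0).eventually (lt_mem_nhds (show u ^ ρ / 2 < u ^ ρ by linarith))
    refine ⟨max (2 * M) (max (u ^ ρ + 1) (2 / u ^ ρ)), ?_⟩
    filter_upwards [e1, e2, e3, e4, hnhds,
      (tendsto_mul_left_nhdsGT_zero hu0).eventually hnhds] with v h1 h2 h3 h4 hv huv
    have gv := hgpos v hv
    have guv := hgpos _ huv
    have lv := hℓpos v (hs1 hv)
    have luv := hℓpos _ (hs1 huv)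
    have av := hapos v (hs2 hv)
    have h1' : |ℓ (u * v) - ℓ v| ≤ M * a v := by
      have : |ℓ (u * v) - ℓ v| / a v < M := by exact_mod_cast h1
      exact ((div_lt_iff₀ av).1 this).le
    refine ⟨?_, ?_, ?_⟩
    · have h5 : φ (u * v) - φ v = Real.log (ℓ (u * v) / ℓ v) := by
        simp only [hφ]; rw [Real.log_div luv.ne' lv.ne']
      rw [h5]
      refine (abs_log_le_two_mul h2.le).trans ?_
      have h6 : |ℓ (u * v) / ℓ v - 1| ≤ M * g v := by
        rw [div_sub_one lv.ne', abs_div, abs_of_pos lv, div_le_iff₀ lv]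
        have : M * g v * ℓ v = M * a v := by simp only [hg]; field_simp
        rwa [this]
      calc 2 * |ℓ (u * v) / ℓ v - 1| ≤ 2 * (M * g v) := by gcongr
        _ = 2 * M * g v := by ring
        _ ≤ _ := by gcongr; exact le_max_left _ _
    · refine ((div_lt_iff₀ gv).1 h3).le.trans ?_
      gcongr
      exact (le_max_left _ _).trans (le_max_right _ _)
    · have h7 : g v ≤ 2 / u ^ ρ * g (u * v) := by
        have := (lt_div_iff₀ gv).1 h4
        rw [div_mul_eq_mul_div, le_div_iff₀ hρ]
        linarith
      refine h7.trans ?_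
      gcongr
      exact (le_max_right _ _).trans (le_max_right _ _)
  obtain ⟨r, hr, C, hC, hloc⟩ := exists_uniform_comparableAt hδ0 hφm hgm hgpos
    (hB.inter measurableSet_Ioo) Set.inter_subset_right hB'pos hpt
  obtain ⟨C', hC', hpot⟩ := exists_potter_bound hr hC hε
    (mem_of_superset hnhds hgpos) haℓ (hgr r hr.1) hloc
  obtain ⟨s, hs, hs'⟩ := mem_nhdsGT_iff_exists_Ioo_subset.1
    (inter_mem (inter_mem hnhds hloc) hpot)
  refine ⟨r, hr, C, C', s, hC, hC', hs, fun v hv => ?_⟩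
  obtain ⟨⟨h1, h2⟩, h3⟩ := hs' hv
  exact ⟨hℓpos v (hs1 h1), hgpos v h1, h2, h3⟩

/-- Near the intermediate threshold `k n / n`, the powers of log-ratios of the quantile function
are those of an exponential variable, up to an error `o(1 / √(k n))` in the mean. -/
lemma exists_approx_log_ratio {q : ℝ → ℝ} (hq : AntitoneOn q (Set.Ioo 0 1))
    {γ p : ℝ} (hγ : 0 < γ) (hp : 0 < p) {ℓ a : ℝ → ℝ} (hℓ : TailIndex.SlowlyVaryingAtZero ℓ)
    (hQ : ∀ s ∈ Set.Ioo (0 : ℝ) 1, q s = s ^ (-γ) * ℓ s)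
    (ha : TailIndex.RegularlyVaryingAtZero a)
    (haℓ : Tendsto (fun v => a v / ℓ v) (𝓝[>] 0) (𝓝 0))
    {B : Set ℝ} (hB : MeasurableSet B) (hB01 : B ⊆ Set.Icc 0 1) (hBpos : 0 < volume B)
    (hsecond : ∀ u ∈ B,
      limsup (fun v : ℝ => ((|ℓ (u * v) - ℓ v| / a v : ℝ) : EReal)) (𝓝[>] 0) < ⊤)
    {k : ℕ → ℕ} (hk : Tendsto k atTop atTop)
    (hkn : Tendsto (fun n : ℕ => (k n : ℝ) / n) atTop (𝓝 0))
    (hrate : Tendsto (fun n : ℕ => √(k n : ℝ) * (a ((k n : ℝ) / n) / ℓ ((k n : ℝ) / n)))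
      atTop (𝓝 0)) :
    ∃ θ > (0 : ℝ), ∃ Ψ : ℝ → ℝ, Integrable Ψ unifMeasure ∧ ∃ η : ℕ → ℝ,
      Tendsto (fun n => √(k n : ℝ) * η n) atTop (𝓝 0) ∧
      ∀ᶠ n : ℕ in atTop, ∀ w ∈ Set.Ioo (0 : ℝ) 1, |w - (k n : ℝ) / n| ≤ θ * ((k n : ℝ) / n) →
        ∀ᵐ v ∂unifMeasure,
          |(Real.log (q (w * v) / q w)) ^ p - (-γ * Real.log v) ^ p| ≤ η n * Ψ v := by
  obtain ⟨ε, hε, Ψ, hΨ, hΨb⟩ := exists_integrable_bound_rpow_sub hγ hp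
  obtain ⟨r, hr, C, C', s, hC, hC', hs, hbound⟩ :=
    exists_second_order_bound hℓ ha haℓ hB hB01 hBpos hsecond hε
  set g : ℝ → ℝ := fun v => a v / ℓ v with hg
  have hx : Tendsto (fun n : ℕ => (k n : ℝ) / n) atTop (𝓝[>] 0) := by
    refine tendsto_nhdsWithin_iff.2 ⟨hkn, ?_⟩
    filter_upwards [hk.eventually_ge_atTop 1, eventually_ge_atTop 1] with n h1 h2
    have h1' : (0 : ℝ) < k n := by exact_mod_cast h1
    have h2' : (0 : ℝ) < n := by exact_mod_cast h2
    exact div_pos h1' h2'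
  have hη0 : Tendsto (fun n : ℕ => C' * C * g ((k n : ℝ) / n)) atTop (𝓝 0) := by
    simpa using (haℓ.comp hx).const_mul (C' * C)
  refine ⟨1 - r, by linarith [hr.2], Ψ, hΨ, fun n => C' * C * g ((k n : ℝ) / n), ?_, ?_⟩
  · have := hrate.const_mul (C' * C)
    rw [mul_zero] at this
    refine this.congr fun n => ?_
    simp only [hg]; ring
  filter_upwards [hx.eventually (Ioo_mem_nhdsGT (show 0 < s / 2 by positivity)),
    hη0.eventually (gt_mem_nhds one_pos)] with n hxs hη1 w hw hwx
  set x := (k n : ℝ) / n with hxdef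
  obtain ⟨hx0, hx1⟩ := hxs
  obtain ⟨hw1, hw2⟩ := abs_le.1 hwx
  have hws : w ∈ Set.Ioo 0 s := ⟨hw.1, by nlinarith [hr.1]⟩
  obtain ⟨lw, gw, cw, pw⟩ := hbound w hws
  obtain ⟨lx, gx, cx, px⟩ := hbound x ⟨hx0, by linarith⟩
  -- `w / x` or `x / w` lies in `[r, 1]`
  have hgw : g w ≤ C * g x := by
    rcases le_total w x with h | h
    · have h1 := (cx (w / x) ⟨by rw [le_div_iff₀ hx0]; linarith, by rwa [div_le_one hx0]⟩).2.1
      rwa [div_mul_cancel₀ _ hx0.ne'] at h1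
    · have h1 := (cw (x / w) ⟨by rw [le_div_iff₀ hw.1]; nlinarith [hr.1, sq_nonneg (1 - r)],
        by rwa [div_le_one hw.1]⟩).2.2
      rwa [div_mul_cancel₀ _ hw.1.ne'] at h1
  filter_upwards [ae_unifMeasure_mem] with v hv
  have hwv : w * v ∈ Set.Ioo (0 : ℝ) 1 :=
    ⟨mul_pos hw.1 hv.1, by nlinarith [hw.1, hw.2, hv.1, hv.2]⟩
  have hwvw : w * v ≤ w := mul_le_of_le_one_right hw.1.le hv.2.le
  have lwv := (hbound (w * v) ⟨hwv.1, hwvw.trans_lt hws.2⟩).1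
  have hqw : 0 < q w := by
    rw [hQ w hw]; exact mul_pos (Real.rpow_pos_of_pos hw.1 _) lw
  have hlog : Real.log (q (w * v) / q w) - -γ * Real.log v =
      Real.log (ℓ (v * w)) - Real.log (ℓ w) := by
    have e : ∀ z : ℝ, 0 < z → 0 < ℓ z → z < 1 → Real.log (q z) = -γ * Real.log z + Real.log (ℓ z) := by
      intro z hz hlz hz1
      rw [hQ z ⟨hz, hz1⟩, Real.log_mul (Real.rpow_pos_of_pos hz _).ne' hlz.ne', Real.log_rpow hz]
    have hqwv : 0 < q (w * v) := hqw.trans_le (hq hwv hw hwvw)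
    rw [Real.log_div hqwv.ne' hqw.ne', e w hw.1 lw hw.2, e _ hwv.1 lwv hwv.2,
      Real.log_mul hw.1.ne' hv.1.ne', mul_comm w v]
    ring
  have hV : 0 < v ^ (-ε) := Real.rpow_pos_of_pos hv.1 _
  refine hΨb v hv _ ⟨?_, hη1.le⟩ _ ?_ ?_
  · have : 0 < g x := gx
    positivity
  · exact Real.log_nonneg ((one_le_div hqw).2 (hq hwv hw hwvw))
  · rw [hlog]
    refine (pw v ⟨hv.1, hv.2.le⟩).trans ?_
    calc C' * g w * v ^ (-ε) ≤ C' * (C * g x) * v ^ (-ε) := by gcongr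
      _ = _ := by ring

/-! ### Convergence in distribution -/

lemma tendstoInDistribution_gaussianReal_of_charFun {Ω : Type*} [MeasurableSpace Ω] {P : Measure Ω}
    [IsProbabilityMeasure P] {X : ℕ → Ω → ℝ} (hX : ∀ n, AEMeasurable (X n) P) {v : ℝ} (hv : 0 ≤ v)
    (h : ∀ t : ℝ, Tendsto (fun n => ∫ ω, Complex.exp ((t * X n ω : ℝ) * Complex.I) ∂P) atTop
      (𝓝 (Complex.exp ((-v * t ^ 2 / 2 : ℝ))))) :
    TendstoInDistribution X atTop id (fun _ => P) (gaussianReal 0 v.toNNReal) where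
  forall_aemeasurable := hX
  tendsto := by
    refine ProbabilityMeasure.tendsto_iff_tendsto_charFun.2 fun t => ?_
    have h1 : charFun ((gaussianReal 0 v.toNNReal).map id) t =
        Complex.exp ((-v * t ^ 2 / 2 : ℝ)) := by
      rw [Measure.map_id, charFun_gaussianReal]
      congr 1
      rw [Real.coe_toNNReal _ hv]
      push_cast
      ring
    have h2 : ∀ n, charFun (P.map (X n)) t = ∫ ω, Complex.exp ((t * X n ω : ℝ) * Complex.I) ∂P := by
      intro n
      rw [charFun_apply_real, integral_map (hX n) (by fun_prop)]
      push_cast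
      rfl
    simp only [ProbabilityMeasure.coe_mk, h1, h2]
    exact h t

lemma tendstoInDistribution_of_map_eq {Ω₁ Ω₂ Ω₃ Ω₄ : Type*} [MeasurableSpace Ω₁]
    [MeasurableSpace Ω₂] [MeasurableSpace Ω₃] [MeasurableSpace Ω₄] {P₁ : Measure Ω₁}
    {P₂ : Measure Ω₂} {P₃ : Measure Ω₃} {P₄ : Measure Ω₄} [IsProbabilityMeasure P₁]
    [IsProbabilityMeasure P₂] [IsProbabilityMeasure P₃] [IsProbabilityMeasure P₄]
    {X : ℕ → Ω₁ → ℝ} {Y : ℕ → Ω₂ → ℝ} {Z : Ω₃ → ℝ} {W : Ω₄ → ℝ}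
    (hY : TendstoInDistribution Y atTop Z (fun _ => P₂) P₃) (hX : ∀ n, AEMeasurable (X n) P₁)
    (hW : AEMeasurable W P₄) (hXY : ∀ᶠ n in atTop, P₁.map (X n) = P₂.map (Y n))
    (hZW : P₃.map Z = P₄.map W) :
    TendstoInDistribution X atTop W (fun _ => P₁) P₄ where
  forall_aemeasurable := hX
  aemeasurable_limit := hW
  tendsto := by
    have h := hY.tendsto
    have h1 : (⟨P₄.map W, Measure.isProbabilityMeasure_map hW⟩ : ProbabilityMeasure ℝ) =
        ⟨P₃.map Z, Measure.isProbabilityMeasure_map hY.aemeasurable_limit⟩ :=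
      Subtype.ext hZW.symm
    rw [h1]
    refine h.congr' ?_
    filter_upwards [hXY] with n hn
    exact Subtype.ext hn.symm

/-- Convergence of the characteristic functions of the normalized sum over the `k n` smallest order
statistics. Conditionally on the order statistic of rank `k n + 1`, the characteristic function is
a `k n`-th power, close to that of a sum of independent powers of exponential variables. -/
lemma tendsto_integral_cexp_sum_orderStat {Ω : Type*} [MeasurableSpace Ω] {P : Measure Ω}
    [IsProbabilityMeasure P] {U : ℕ → Ω → ℝ} (hU : ∀ i, HasLaw (U i) unifMeasure P)
    (hUind : iIndepFun U P) {q : ℝ → ℝ} (hq : Measurable q) {γ p : ℝ} (hγ : 0 < γ) (hp : 0 < p)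
    {k : ℕ → ℕ} (hk : Tendsto k atTop atTop)
    (hkn : Tendsto (fun n : ℕ => (k n : ℝ) / n) atTop (𝓝 0))
    {θ : ℝ} (hθ : 0 < θ) {Ψ : ℝ → ℝ} (hΨ : Integrable Ψ unifMeasure) {η : ℕ → ℝ}
    (hη : Tendsto (fun n => √(k n : ℝ) * η n) atTop (𝓝 0))
    (happrox : ∀ᶠ n : ℕ in atTop, ∀ w ∈ Set.Ioo (0 : ℝ) 1,
      |w - (k n : ℝ) / n| ≤ θ * ((k n : ℝ) / n) → ∀ᵐ v ∂unifMeasure,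
        |(Real.log (q (w * v) / q w)) ^ p - (-γ * Real.log v) ^ p| ≤ η n * Ψ v) (t : ℝ) :
    Tendsto (fun n : ℕ => ∫ ω, Complex.exp ((t * (1 / √(k n : ℝ) * ∑ i ∈ Finset.Icc 1 (k n),
        ((Real.log (q (TailIndex.orderStat (fun j => U j ω) n i) /
          q (TailIndex.orderStat (fun j => U j ω) n (k n + 1)))) ^ p
            - γ ^ p * Real.Gamma (p + 1))) : ℝ) * Complex.I) ∂P) atTop
      (𝓝 (Complex.exp ((-TailIndex.sigmaSq γ p * t ^ 2 / 2 : ℝ)))) := by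
  set c := γ ^ p * Real.Gamma (p + 1) with hc
  set L : ℂ := Complex.exp ((-TailIndex.sigmaSq γ p * t ^ 2 / 2 : ℝ)) with hL
  have hL1 : ‖L‖ ≤ 1 := by
    rw [hL, Complex.norm_exp_ofReal, Real.exp_le_one_iff]
    have := mul_nonneg (sigmaSq_nonneg hγ hp) (sq_nonneg t)
    linarith
  obtain ⟨hi1, he1⟩ := integral_neg_log_rpow hγ hp
  obtain ⟨hi2, he2⟩ := sigmaSq_eq_integral hγ hp
  set A : ℕ → ℂ := fun n => ∫ v, Complex.exp (((√(n : ℝ))⁻¹ * t *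
    ((-γ * Real.log v) ^ p - c) : ℝ) * Complex.I) ∂unifMeasure with hA
  have hAlim : Tendsto (fun n => A n ^ n) atTop (𝓝 L) := by
    have := tendsto_integral_cexp_pow (P := unifMeasure)
      (Z := fun v => (-γ * Real.log v) ^ p - c) (by fun_prop)
      (by rw [integral_sub hi1 (integrable_const _), he1]; simp [hc]) hi2 t
    rw [he2] at this
    exact this
  -- the two terms of the bound: the conditional error, and the relative variance
  set b : ℕ → ℝ := fun n => |√(k n : ℝ) * η n| * (|t| * |∫ v, Ψ v ∂unifMeasure|) +
    ‖A (k n) ^ (k n) - L‖ with hb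
  have hblim : Tendsto b atTop (𝓝 0) := by
    have h1 := (hη.abs).mul_const (|t| * |∫ v, Ψ v ∂unifMeasure|)
    have h2 := (tendsto_iff_norm_sub_tendsto_zero.1 hAlim).comp hk
    rw [abs_zero, zero_mul] at h1
    have h3 := h1.add h2
    rw [add_zero] at h3
    exact h3
  have hvar := (tendsto_relative_variance hk).const_mul (2 / θ ^ 2)
  rw [mul_zero] at hvar
  have hsum := hblim.add hvar
  rw [add_zero] at hsum
  refine tendsto_iff_norm_sub_tendsto_zero.2 (squeeze_zero' (Eventually.of_forall fun _ =>
    norm_nonneg _) ?_ hsum)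
  filter_upwards [happrox, hk.eventually_ge_atTop 1, hkn.eventually (gt_mem_nhds one_pos),
    eventually_ge_atTop 1] with n hn hk1 hkn1 hn1
  have hn0 : (0 : ℝ) < n := by exact_mod_cast hn1
  have hk0 : (0 : ℝ) < k n := by exact_mod_cast hk1
  have hkn' : k n < n := by
    have := (div_lt_one hn0).1 hkn1
    exact_mod_cast this
  obtain ⟨m, rfl⟩ : ∃ m, n = m + 1 := ⟨n - 1, by omega⟩
  set κ := k (m + 1) with hκ
  have hsq : (0 : ℝ) < √(κ : ℝ) := Real.sqrt_pos.2 hk0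
  set f : ℝ → ℝ → ℝ := fun u w => (√(κ : ℝ))⁻¹ * t * ((Real.log (q u / q w)) ^ p - c) with hf
  set e : ℝ → ℝ → ℂ := fun u w => Complex.exp (f u w * Complex.I) with he
  have hfm : Measurable (Function.uncurry f) := by
    have h1 : Measurable fun z : ℝ × ℝ => q z.1 := hq.comp measurable_fst
    have h2 : Measurable fun z : ℝ × ℝ => q z.2 := hq.comp measurable_snd
    exact (((Real.measurable_log.comp (h1.div h2)).pow_const p).sub_const c).const_mul _
  have hem : Measurable (Function.uncurry e) :=
    Complex.measurable_exp.comp ((Complex.measurable_ofReal.comp hfm).mul_const _)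
  have he1 : ∀ u w, ‖e u w‖ ≤ 1 := fun u w => by
    simp only [he]; rw [Complex.norm_exp_ofReal_mul_I]
  have hstat : ∫ ω, Complex.exp ((t * (1 / √(κ : ℝ) * ∑ i ∈ Finset.Icc 1 κ,
        ((Real.log (q (TailIndex.orderStat (fun j => U j ω) (m + 1) i) /
          q (TailIndex.orderStat (fun j => U j ω) (m + 1) (κ + 1)))) ^ p - c)) : ℝ) *
            Complex.I) ∂P =
      ∫ x : Fin (m + 1) → ℝ,
        ∏ i : Fin κ, e (sortedTuple x (i.castLE hkn'.le)) (sortedTuple x ⟨κ, hkn'⟩)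
          ∂(Measure.pi fun _ => unifMeasure) := by
    rw [← map_fin_eq_pi hU hUind (m + 1), integral_map]
    · refine integral_congr_ae (ae_of_all _ fun ω => ?_)
      simp only
      rw [← prod_orderStat_eq hkn' e (fun j => U j ω)]
      simp only [he]
      rw [← Complex.exp_sum, ← Finset.sum_mul, ← Complex.ofReal_sum]
      simp only [hf]
      rw [← Finset.mul_sum]
      congr 3
      ring
    · exact aemeasurable_pi_lambda _ fun j => (hU j).aemeasurable
    · exact (measurable_prod_sortedTuple hem hkn').aestronglyMeasurable
  rw [hstat]
  have hx0 : (0 : ℝ) < (κ : ℝ) / ((m + 1 : ℕ) : ℝ) := div_pos hk0 hn0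
  refine (norm_integral_prod_sortedTuple_sub_le hem he1 hkn' hL1 (δ := b (m + 1))
    (by simp only [hb]; positivity) hx0 hθ ?_).trans (le_of_eq ?_)
  · intro w hw hwx
    have hAe : ‖(∫ v, e (w * v) w ∂unifMeasure) - A κ‖ ≤
        ∫ v, (√(κ : ℝ))⁻¹ * |t| * (η (m + 1) * Ψ v) ∂unifMeasure := by
      simp only [he, hA]
      refine norm_integral_cexp_sub_le ?_ (by fun_prop) ((hΨ.const_mul _).const_mul _) ?_
      · exact (hfm.comp (by fun_prop : Measurable fun v : ℝ => (w * v, w))).aemeasurable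
      · filter_upwards [hn w hw hwx] with v hv
        simp only [hf]
        rw [← mul_sub, sub_sub_sub_cancel_right, abs_mul, abs_mul, abs_inv, abs_of_pos hsq]
        gcongr
    rw [integral_const_mul, integral_const_mul] at hAe
    have hB1 : ‖∫ v, e (w * v) w ∂unifMeasure‖ ≤ 1 :=
      norm_integral_cexp_le_one (P := unifMeasure) fun v => f (w * v) w
    have hA1 : ‖A κ‖ ≤ 1 := norm_integral_cexp_le_one (P := unifMeasure) _
    calc ‖(∫ v, e (w * v) w ∂unifMeasure) ^ κ - L‖
        ≤ ‖(∫ v, e (w * v) w ∂unifMeasure) ^ κ - A κ ^ κ‖ + ‖A κ ^ κ - L‖ :=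
          norm_sub_le_norm_sub_add_norm_sub _ _ _
      _ ≤ κ * ((√(κ : ℝ))⁻¹ * |t| * (η (m + 1) * ∫ v, Ψ v ∂unifMeasure)) + ‖A κ ^ κ - L‖ := by
          gcongr
          exact (norm_pow_sub_pow_le_of_norm_le_one hB1 hA1 κ).trans (by gcongr)
      _ = √(κ : ℝ) * η (m + 1) * (|t| * ∫ v, Ψ v ∂unifMeasure) + ‖A κ ^ κ - L‖ := by
          have : (κ : ℝ) * (√(κ : ℝ))⁻¹ = √(κ : ℝ) := by
            rw [← div_eq_mul_inv, Real.div_sqrt]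
          linear_combination (|t| * η (m + 1) * ∫ v, Ψ v ∂unifMeasure) * this
      _ ≤ b (m + 1) := by
          simp only [hb, ← hκ]
          gcongr ?_ + _
          refine (le_abs_self _).trans (le_of_eq ?_)
          rw [abs_mul, abs_mul (|t|), abs_abs]
  · congr 1
    push_cast
    have h2 : (m : ℝ) + 1 + 1 = m + 2 := by ring
    have h3 : (m : ℝ) + 1 + 2 = m + 3 := by ring
    rw [h2, h3, mul_pow]
    have : θ ≠ 0 := hθ.ne'
    have : (κ : ℝ) ≠ 0 := hk0.ne'
    field_simp

/-- The delta method for the map `z ↦ z ^ (1 / p)` at `γ ^ p`. The difference quotient is extended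
continuously by `dslope`, so that Slutsky's theorem for a continuous function applies to the pair
formed by the statistic and the deterministic sequence `1 / s n`. -/
lemma tendstoInDistribution_rpow_delta {Ω : Type*} [MeasurableSpace Ω] {P : Measure Ω}
    [IsProbabilityMeasure P] {T : ℕ → Ω → ℝ} {v : ℝ} (hv : 0 ≤ v)
    (hT : TendstoInDistribution T atTop id (fun _ => P) (gaussianReal 0 v.toNNReal))
    {γ p G : ℝ} (hγ : 0 < γ) (hp : 0 < p) {s : ℕ → ℝ}
    (hs : Tendsto (fun n => (s n)⁻¹) atTop (𝓝 0)) :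
    TendstoInDistribution (fun n ω => p / G * T n ω *
        dslope (fun z : ℝ => z ^ (1 / p)) (γ ^ p) (γ ^ p + T n ω * (s n)⁻¹ / G)) atTop id
      (fun _ => P) (gaussianReal 0 (γ ^ (2 * (1 - p)) * v / G ^ 2).toNNReal) := by
  set h : ℝ → ℝ := fun z => z ^ (1 / p) with hh
  have hb : 0 < γ ^ p := Real.rpow_pos_of_pos hγ p
  have hder : HasDerivAt h (1 / p * (γ ^ p) ^ (1 / p - 1)) (γ ^ p) :=
    Real.hasDerivAt_rpow_const (Or.inl hb.ne')
  have hcont : Continuous (dslope h (γ ^ p)) := by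
    rw [← continuousOn_univ, continuousOn_dslope univ_mem]
    exact ⟨(Real.continuous_rpow_const (by positivity)).continuousOn, hder.differentiableAt⟩
  have hgc : Continuous (fun z : ℝ × ℝ => p / G * z.1 * dslope h (γ ^ p) (γ ^ p + z.1 * z.2 / G)) := by
    fun_prop
  have hY : TendstoInMeasure P (fun n (_ : Ω) => (s n)⁻¹) atTop (fun _ => (0 : ℝ)) :=
    tendstoInMeasure_of_tendsto_ae (fun n => aestronglyMeasurable_const)
      (ae_of_all _ fun _ => hs)
  have hconv := hT.continuous_comp_prodMk_of_tendstoInMeasure_const hgc hY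
    (fun n => aemeasurable_const)
  refine tendstoInDistribution_of_map_eq hconv hconv.forall_aemeasurable aemeasurable_id
    (Eventually.of_forall fun n => rfl) ?_
  -- the limit is `p / G * h' (γ ^ p)` times the identity
  have hlim : (fun ω : ℝ => p / G * id ω * dslope h (γ ^ p) (γ ^ p + id ω * 0 / G)) =
      fun ω => (γ ^ (1 - p) / G) * ω := by
    ext ω
    have h1 : (γ ^ p) ^ (1 / p - 1) = γ ^ (1 - p) := by
      rw [← Real.rpow_mul hγ.le]; congr 1; field_simp
    simp only [id, mul_zero, zero_div, add_zero, dslope_same, hder.deriv, h1]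
    field_simp
  rw [hlim, gaussianReal_map_const_mul, Measure.map_id, mul_zero]
  congr 1
  ext
  have h2 : (γ ^ (1 - p)) ^ 2 = γ ^ (2 * (1 - p)) := by
    rw [mul_comm, Real.rpow_mul hγ.le, Real.rpow_two]
  rw [Real.coe_toNNReal _ (by positivity), NNReal.coe_mul, Real.coe_toNNReal _ hv]
  simp only [NNReal.coe_mk]
  rw [div_pow, h2]
  ring

lemma measurable_tailEstimator (p : ℝ) (k n : ℕ) :
    Measurable (fun x : ℕ → ℝ => TailIndex.tailEstimator p k n x) := by
  unfold TailIndex.tailEstimator TailIndex.powerSum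
  refine Measurable.pow_const (Measurable.div_const (Measurable.const_mul
    (Finset.measurable_sum _ fun i _ => ?_) _) _) _
  exact (Real.measurable_log.comp ((measurable_orderStat _ _).div
    (measurable_orderStat _ _))).pow_const p

/-- Two iid sequences with the same marginal law have the same law as sequences. -/
lemma map_eq_map_of_iid {Ω Ω' : Type*} [MeasurableSpace Ω] [MeasurableSpace Ω'] {P : Measure Ω}
    {P' : Measure Ω'} [IsProbabilityMeasure P] [IsProbabilityMeasure P'] {μ : Measure ℝ}
    {X : ℕ → Ω → ℝ} {Y : ℕ → Ω' → ℝ} (hX : ∀ i, HasLaw (X i) μ P) (hXind : iIndepFun X P)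
    (hY : ∀ i, HasLaw (Y i) μ P') (hYind : iIndepFun Y P') :
    P.map (fun ω i => X i ω) = P'.map (fun ω i => Y i ω) := by
  rw [(iIndepFun_iff_map_fun_eq_infinitePi_map₀' (fun i => (hX i).aemeasurable)).1 hXind,
    (iIndepFun_iff_map_fun_eq_infinitePi_map₀' (fun i => (hY i).aemeasurable)).1 hYind]
  congr 1
  ext1 i
  rw [(hX i).map_eq, (hY i).map_eq]

/-! ### Asymptotic normality of the power sums and of the tail estimator -/

theorem mainTheorem2
    {Ω Ω' : Type*} [MeasurableSpace Ω] [MeasurableSpace Ω']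
    (P : Measure Ω) [IsProbabilityMeasure P] (P' : Measure Ω') [IsProbabilityMeasure P']
    -- the common law of the sample
    (μ : Measure ℝ) [IsProbabilityMeasure μ]
    -- the iid sample
    (X : ℕ → Ω → ℝ) (hX : ∀ i, HasLaw (X i) μ P) (hXind : iIndepFun X P)
    -- iid uniform (0,1) variables
    (U : ℕ → Ω' → ℝ) (hU : ∀ i, HasLaw (U i) (volume.restrict (Set.Ioo (0 : ℝ) 1)) P')
    (hUind : iIndepFun U P')
    (γ p : ℝ) (hγ : 0 < γ) (hp : 0 < p)
    -- regular variation of the quantile function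
    (ℓ : ℝ → ℝ) (hℓ : TailIndex.SlowlyVaryingAtZero ℓ)
    (hQ : ∀ s ∈ Set.Ioo (0 : ℝ) 1, TailIndex.quantile μ (1 - s) = s ^ (-γ) * ℓ s)
    -- weak second-order condition
    (a : ℝ → ℝ) (ha : TailIndex.RegularlyVaryingAtZero a)
    (haℓ : Tendsto (fun v => a v / ℓ v) (𝓝[>] 0) (𝓝 0))
    (B : Set ℝ) (hB : MeasurableSet B) (hB01 : B ⊆ Set.Icc 0 1) (hBpos : 0 < volume B)
    (hsecond : ∀ u ∈ B,
      limsup (fun v : ℝ => ((|ℓ (u * v) - ℓ v| / a v : ℝ) : EReal)) (𝓝[>] 0) < ⊤)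
    -- the intermediate sequence
    (k : ℕ → ℕ) (hk1 : ∀ n, 1 ≤ n → 1 ≤ k n ∧ k n ≤ n)
    (hk : Tendsto k atTop atTop)
    (hkn : Tendsto (fun n : ℕ => (k n : ℝ) / n) atTop (𝓝 0))
    (hrate : Tendsto (fun n : ℕ => √(k n : ℝ) * (a ((k n : ℝ) / n) / ℓ ((k n : ℝ) / n)))
      atTop (𝓝 0)) :
    TendstoInDistribution
      (fun (n : ℕ) (ω : Ω') => 1 / √(k n : ℝ) * ∑ i ∈ Finset.Icc 1 (k n),
        ((Real.log
            (TailIndex.quantile μ (1 - TailIndex.orderStat (fun j => U j ω) n i) /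
              TailIndex.quantile μ (1 - TailIndex.orderStat (fun j => U j ω) n (k n + 1)))) ^ p
          - γ ^ p * Real.Gamma (p + 1)))
      atTop id (fun _ => P') (gaussianReal 0 (TailIndex.sigmaSq γ p).toNNReal) ∧
    TendstoInDistribution
      (fun (n : ℕ) (ω : Ω) =>
        p * √(k n : ℝ) * (TailIndex.tailEstimator p (k n) n (fun j => X j ω) - γ))
      atTop id (fun _ => P)
      (gaussianReal 0
        (γ ^ (2 * (1 - p)) * TailIndex.sigmaSq γ p / Real.Gamma (p + 1) ^ 2).toNNReal) := by
  set q : ℝ → ℝ := upperQuantile μ with hq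
  have hqm : Measurable q := measurable_upperQuantile μ
  have hqa : AntitoneOn q (Set.Ioo 0 1) := antitoneOn_upperQuantile μ
  have hσ := sigmaSq_nonneg hγ hp
  have hG : 0 < Real.Gamma (p + 1) := Real.Gamma_pos_of_pos (by linarith)
  have hUm : AEMeasurable (fun ω j => U j ω) P' :=
    aemeasurable_pi_lambda _ fun j => (hU j).aemeasurable
  have hXm : AEMeasurable (fun ω j => X j ω) P :=
    aemeasurable_pi_lambda _ fun j => (hX j).aemeasurable
  set c := γ ^ p * Real.Gamma (p + 1) with hc
  set T : ℕ → Ω' → ℝ := fun n ω => 1 / √(k n : ℝ) * ∑ i ∈ Finset.Icc 1 (k n),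
    ((Real.log (q (TailIndex.orderStat (fun j => U j ω) n i) /
      q (TailIndex.orderStat (fun j => U j ω) n (k n + 1)))) ^ p - c) with hT
  have hTm : ∀ n, AEMeasurable (T n) P' := by
    intro n
    have h1 : ∀ i, AEMeasurable (fun ω => q (TailIndex.orderStat (fun j => U j ω) n i)) P' :=
      fun i => (hqm.comp (measurable_orderStat n i)).comp_aemeasurable hUm
    refine AEMeasurable.const_mul (Finset.aemeasurable_fun_sum _ fun i _ => ?_) _
    exact ((Real.measurable_log.comp_aemeasurable ((h1 i).div (h1 _))).pow_const p).sub_const c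
  have hlim : TendstoInDistribution T atTop id (fun _ => P')
      (gaussianReal 0 (TailIndex.sigmaSq γ p).toNNReal) := by
    obtain ⟨θ, hθ, Ψ, hΨ, η, hη, happrox⟩ := exists_approx_log_ratio hqa hγ hp hℓ hQ ha haℓ hB
      hB01 hBpos hsecond hk hkn hrate
    exact tendstoInDistribution_gaussianReal_of_charFun hTm hσ fun t =>
      tendsto_integral_cexp_sum_orderStat hU hUind hqm hγ hp hk hkn hθ hΨ hη happrox t
  refine ⟨hlim, ?_⟩
  have hsqrt : Tendsto (fun n => (√(k n : ℝ))⁻¹) atTop (𝓝 0) :=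
    tendsto_inv_atTop_zero.comp (Real.tendsto_sqrt_atTop.comp
      (tendsto_natCast_atTop_atTop.comp hk))
  have hdelta := tendstoInDistribution_rpow_delta hσ hlim hγ hp (G := Real.Gamma (p + 1)) hsqrt
  have hFm : ∀ n, Measurable (fun x : ℕ → ℝ =>
      p * √(k n : ℝ) * (TailIndex.tailEstimator p (k n) n x - γ)) := fun n =>
    ((measurable_tailEstimator p (k n) n).sub_const γ).const_mul _
  refine tendstoInDistribution_of_map_eq hdelta (fun n => (hFm n).comp_aemeasurable hXm)
    aemeasurable_id ?_ rfl
  -- the sample `X` and the sequence `q (U j)` have the same law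
  have hlaw : P.map (fun ω j => X j ω) = P'.map (fun ω j => q (U j ω)) := by
    refine map_eq_map_of_iid hX hXind (fun j => ⟨hqm.comp_aemeasurable (hU j).aemeasurable, ?_⟩)
      (hUind.comp (fun _ => q) fun _ => hqm)
    have h1 := AEMeasurable.map_map_of_aemeasurable hqm.aemeasurable (hU j).aemeasurable
    rw [(hU j).map_eq] at h1
    exact h1.symm.trans (map_upperQuantile μ)
  have hqUm : AEMeasurable (fun ω j => q (U j ω)) P' :=
    aemeasurable_pi_lambda _ fun j => hqm.comp_aemeasurable (hU j).aemeasurable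
  have hU01 : ∀ᵐ ω ∂P', ∀ j, U j ω ∈ Set.Ioo (0 : ℝ) 1 := by
    refine ae_all_iff.2 fun j => ?_
    have h1 : ∀ᵐ u ∂(P'.map (U j)), u ∈ Set.Ioo (0 : ℝ) 1 := by
      rw [(hU j).map_eq]; exact ae_unifMeasure_mem
    exact ae_of_ae_map (hU j).aemeasurable h1
  filter_upwards [hk.eventually_ge_atTop 1, hkn.eventually (gt_mem_nhds one_pos),
    eventually_ge_atTop 1] with n hk1 hkn1 hn1
  have hk0 : (0 : ℝ) < k n := by exact_mod_cast hk1
  have hkn' : k n < n := by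
    have := (div_lt_one (by exact_mod_cast hn1 : (0 : ℝ) < n)).1 hkn1
    exact_mod_cast this
  have h1 := AEMeasurable.map_map_of_aemeasurable (hFm n).aemeasurable hXm
  have h2 := AEMeasurable.map_map_of_aemeasurable (hFm n).aemeasurable hqUm
  rw [hlaw] at h1
  refine h1.symm.trans (h2.trans (Measure.map_congr ?_))
  filter_upwards [hU01] with ω hω
  simp only [Function.comp_apply]
  have hsq : (0 : ℝ) < √(k n : ℝ) := Real.sqrt_pos.2 hk0
  have hS : TailIndex.powerSum p (k n) n (fun j => q (U j ω)) = c + T n ω * (√(k n : ℝ))⁻¹ := by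
    rw [powerSum_comp_antitoneOn hqa p hkn' fun j _ => hω j]
    simp only [hT]
    rw [Finset.sum_sub_distrib, Finset.sum_const, Nat.card_Icc, Nat.add_sub_cancel, nsmul_eq_mul]
    have h3 : (√(k n : ℝ))⁻¹ * (√(k n : ℝ))⁻¹ = (k n : ℝ)⁻¹ := by
      rw [← mul_inv, Real.mul_self_sqrt hk0.le]
    rw [one_div, mul_right_comm, h3, mul_sub, inv_mul_cancel_left₀ hk0.ne']
    ring
  set h : ℝ → ℝ := fun z => z ^ (1 / p) with hh
  set y := T n ω * (√(k n : ℝ))⁻¹ / Real.Gamma (p + 1) with hy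
  have hest : TailIndex.tailEstimator p (k n) n (fun j => q (U j ω)) = h (γ ^ p + y) := by
    simp only [TailIndex.tailEstimator, hS, hh]
    congr 1
    rw [add_div, hc, mul_div_cancel_right₀ _ hG.ne']
  have hγh : h (γ ^ p) = γ := by
    simp only [hh]
    rw [← Real.rpow_mul hγ.le, mul_one_div_cancel hp.ne', Real.rpow_one]
  have hds : y * dslope h (γ ^ p) (γ ^ p + y) = h (γ ^ p + y) - γ := by
    have := sub_smul_dslope h (γ ^ p) (γ ^ p + y)
    rwa [add_sub_cancel_left, smul_eq_mul, hγh] at this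
  rw [hest, ← hds, hy]
  field_simp
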